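/- **Setting.** For a nonnegative matrix $A\in\mathbb R_{\ge0}^{n\times n}$ let $r(A)=A\mathbf 1$ and $c(A)=A^{\top}\mathbf 1$ be its row and column sums. $A$ is $\varepsilon$-balanced if $\|r(A)-c(A)\|_1\le\varepsilon\sum_{ij}A_{ij}$ (and balanced if $r(A)=c(A)$). Let $K\in\mathbb R_{\ge0}^{n\times n}$, $n\ge1$, have no zero row and be balanceable, i.e. $\mathrm{diag}(e^{x})K\,\mathrm{diag}(e^{-x})$ is balanced for some $x\in\mathbb R^n$. The problem $\mathrm{ABAL}(K,\varepsilon)$, $\varepsilon>0$, is to compute $x\in\mathbb R^n$ such that $\mathrm{diag}(e^{x})K\,\mathrm{diag}(e^{-x})$ is $\varepsilon$-balanced. Let $m$ be the number of nonzero entries of $K$, $\kappa=(\sum_{ij}K_{ij})/\min_{K_{ij}\ne0}K_{ij}$, $G_K$ the directed graph on $[n]$ with an edge $(i,j)$ whenever $K_{ij}\neq0$, and $d\in\mathbb N\cup\{\infty\}$ its (directed) diameter. A coloring of $G_K$ of size $p$ is a partition of $[n]$ into nonempty blocks $S_1,\dots,S_p$ such that distinct vertices of the same block are not adjacent in $G_K$.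 Write $a\wedge b=\min(a,b)$ and $$R:=\tfrac1\varepsilon\left(\tfrac1\varepsilon\wedge d\right)\log\kappa .$$ **Block Osborne.** Given a coloring of size $p$, start from $x=\mathbf 0$; as long as $A=\mathrm{diag}(e^{x})K\,\mathrm{diag}(e^{-x})$ is not $\varepsilon$-balanced, perform a round: choose a block $S_\ell$ and simultaneously replace $x_k$ by $x_k+\tfrac12(\log c_k(A)-\log r_k(A))$ for all $k\in S_\ell$. *Greedy* Block Osborne chooses a block maximizing $\sum_{k\in S_\ell}(\sqrt{r_k(A)}-\sqrt{c_k(A)})^2$ (ties broken arbitrarily); *Random* Block Osborne draws $\ell$ uniformly from $[p]$, independently in all rounds; *Cyclic* Block Osborne runs through all blocks in cycles, using an independent uniformly random order in each cycle. The total work is the number of arithmetic operations on real numbers (including $\exp$, $\log$, $\sqrt{\cdot}$, $|\cdot|$), comparisons and random block draws, in an implementation that stores $x$, the row and column sums of $A$, the sum of the entries of $A$ and $\|r(A)-c(A)\|_1$, and updates them along the nonzero entries in the rows and columns of the chosen block; preprocessing, termination tests and the selection of blocks are included. **Theorem (convergence of Block Osborne variants).** There is a universal constant $C>0$ such that for all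 such $K$, all $\varepsilon>0$ and every coloring of $G_K$ of size $p$: * Greedy Block Osborne solves $\mathrm{ABAL}(K,\varepsilon)$ in at most $C\,p\,R$ rounds and $C\,m\,p\,R$ total work. * Random Block Osborne solves $\mathrm{ABAL}(K,\varepsilon)$ in $O(p\,R)$ rounds and $O(m\,R)$ total work, in expectation and with high probability. * Cyclic Block Osborne solves $\mathrm{ABAL}(K,\varepsilon)$ in $O(p^{3/2}R)$ rounds and $O(m\sqrt p\,R)$ total work, in expectation and with high probability. Here a random quantity $T$ is $O(B)$ in expectation and with high probability if $\mathbb E[T]\le C B$ and $\Pr\big(T\le C\,B\log\tfrac1\delta\big)\ge1-\delta$ for every $\delta\in(0,\tfrac12]$. The bounds on the total work are claimed for $n\ge2$ and $\varepsilon\le2$ (otherwise $x=\mathbf 0$ already solves the problem and only the preprocessing is performed). The implementation computes exactly the iterates above, and stops exactly when $A$ is $\varepsilon$-balanced. -/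

import Mathlib

open scoped ENNReal

universe u

noncomputable section

namespace BlockOsborne

/-! ### Matrix balancing -/

/-- Row sums `r(A) = A 1`. -/
def rowSum {n : ℕ} (A : Matrix (Fin n) (Fin n) ℝ) (i : Fin n) : ℝ := ∑ j, A i j

/-- Column sums `c(A) = Aᵀ 1`. -/
def colSum {n : ℕ} (A : Matrix (Fin n) (Fin n) ℝ) (j : Fin n) : ℝ := ∑ i, A i j

/-- Sum of all entries. -/
def total {n : ℕ} (A : Matrix (Fin n) (Fin n) ℝ) : ℝ := ∑ i, ∑ j, A i j

/-- The diagonal scaling `diag(e^x) K diag(e^{-x})`. -/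
def scaling {n : ℕ} (K : Matrix (Fin n) (Fin n) ℝ) (x : Fin n → ℝ) : Matrix (Fin n) (Fin n) ℝ :=
  Matrix.diagonal (fun i => Real.exp (x i)) * K * Matrix.diagonal (fun i => Real.exp (-x i))

/-- `BAL(K)` has a solution. -/
def Balanceable {n : ℕ} (K : Matrix (Fin n) (Fin n) ℝ) : Prop :=
  ∃ x : Fin n → ℝ, rowSum (scaling K x) = colSum (scaling K x)

/-- `A` is `ε`-balanced in the `ℓ₁` sense. -/
def IsEpsBalanced {n : ℕ} (ε : ℝ) (A : Matrix (Fin n) (Fin n) ℝ) : Prop :=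
  (∑ i, |rowSum A i - colSum A i|) / total A ≤ ε

/-! ### Parameters of the input -/

/-- The number `m` of nonzero entries. -/
def numNonzero {n : ℕ} (K : Matrix (Fin n) (Fin n) ℝ) : ℕ :=
  (Finset.univ.filter fun e : Fin n × Fin n => K e.1 e.2 ≠ 0).card

/-- The smallest nonzero entry. -/
def minEntry {n : ℕ} (K : Matrix (Fin n) (Fin n) ℝ) : ℝ :=
  sInf {a : ℝ | a ≠ 0 ∧ ∃ i j, K i j = a}

/-- The condition number `κ = (∑ K i j) / K_min`. -/
def condNumber {n : ℕ} (K : Matrix (Fin n) (Fin n) ℝ) : ℝ := total K / minEntry K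

/-- In the directed graph `G_K` (an edge from `i` to `j` when `K i j ≠ 0`) there is a walk of length
exactly `k` from `i` to `j`. -/
def HasWalk {n : ℕ} (K : Matrix (Fin n) (Fin n) ℝ) : ℕ → Fin n → Fin n → Prop
  | 0, i, j => i = j
  | k + 1, i, j => ∃ l, K i l ≠ 0 ∧ HasWalk K k l j

/-- Directed distance in `G_K`, infinite if there is no walk. -/
def graphDist {n : ℕ} (K : Matrix (Fin n) (Fin n) ℝ) (i j : Fin n) : ℕ∞ :=
  ⨅ (k : ℕ) (_ : HasWalk K k i j), (k : ℕ∞)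

/-- The diameter `d` of the directed graph `G_K`; it is finite iff `G_K` is strongly connected. -/
def diameter {n : ℕ} (K : Matrix (Fin n) (Fin n) ℝ) : ℕ∞ := ⨆ (i : Fin n) (j : Fin n), graphDist K i j

/-- The quantity `(1/ε) * min (1/ε) d * log κ`; the minimum is `1/ε` if `d` is infinite. -/
def baseRate {n : ℕ} (K : Matrix (Fin n) (Fin n) ℝ) (ε : ℝ) : ℝ :=
  1 / ε * (min (ENNReal.ofReal (1 / ε)) (diameter K : ℝ≥0∞)).toReal * Real.log (condNumber K)

/-- A coloring of `G_K` with `p` colors, i.e. a partition of the vertices into `p` nonempty blocks in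
which distinct vertices of the same block are not adjacent. -/
def IsColoring {n p : ℕ} (K : Matrix (Fin n) (Fin n) ℝ) (color : Fin n → Fin p) : Prop :=
  Function.Surjective color ∧ ∀ i j, i ≠ j → color i = color j → K i j = 0

/-! ### Block Osborne -/

/-- Simultaneous Osborne updates of all coordinates in the block of color `b`. -/
def blockUpdate {n p : ℕ} (K : Matrix (Fin n) (Fin n) ℝ) (color : Fin n → Fin p) (b : Fin p)
    (x : Fin n → ℝ) : Fin n → ℝ := fun k =>
  if color k = b then
    x k + (Real.log (colSum (scaling K x) k) - Real.log (rowSum (scaling K x) k)) / 2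
  else x k

/-- The iterates when block `ℓ t` is updated in round `t` (rounds are numbered from `0`). -/
def iterate {n p : ℕ} (K : Matrix (Fin n) (Fin n) ℝ) (color : Fin n → Fin p) (ℓ : ℕ → Fin p) :
    ℕ → Fin n → ℝ
  | 0 => 0
  | t + 1 => blockUpdate K color (ℓ t) (iterate K color ℓ t)

/-- The number of rounds until the current scaling is `ε`-balanced (infinite if this never happens). -/
def rounds {n p : ℕ} (K : Matrix (Fin n) (Fin n) ℝ) (ε : ℝ) (color : Fin n → Fin p)
    (ℓ : ℕ → Fin p) : ℕ∞ :=
  ⨅ (t : ℕ) (_ : IsEpsBalanced ε (scaling K (iterate K color ℓ t))), (t : ℕ∞)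

/-- The imbalance `∑_{k ∈ S_b} (√r_k(A) - √c_k(A))²` of a block. -/
def blockImbalance {n p : ℕ} (A : Matrix (Fin n) (Fin n) ℝ) (color : Fin n → Fin p) (b : Fin p) : ℝ :=
  ∑ k with color k = b, (Real.sqrt (rowSum A k) - Real.sqrt (colSum A k)) ^ 2

/-- `ℓ` is a possible sequence of choices of Greedy Block Osborne: each chosen block has maximal
imbalance; ties are broken arbitrarily. -/
def IsGreedy {n p : ℕ} (K : Matrix (Fin n) (Fin n) ℝ) (color : Fin n → Fin p) (ℓ : ℕ → Fin p) : Prop :=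
  ∀ t b, blockImbalance (scaling K (iterate K color ℓ t)) color b ≤
    blockImbalance (scaling K (iterate K color ℓ t)) color (ℓ t)

/-- `ξ 0, ξ 1, …` are independent and uniformly distributed on the finite set `α`. -/
structure IsIIDUniform {Ω : Type u} [MeasurableSpace Ω] {α : Type} [Fintype α]
    (μ : MeasureTheory.Measure Ω) (ξ : ℕ → Ω → α) : Prop where
  measurable : ∀ t, @Measurable Ω α _ ⊤ (ξ t)
  indep : ProbabilityTheory.iIndepFun (m := fun _ => ⊤) ξ μ
  uniform : ∀ t a, μ {ω | ξ t ω = a} = ((Fintype.card α : ℕ) : ℝ≥0∞)⁻¹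

/-- The order in which the blocks are updated when cycle `q` uses the permutation `σ q`: round
`t = q * p + s` with `s < p` updates block `σ q s`. -/
def cyclicOrder {p : ℕ} (σ : ℕ → Equiv.Perm (Fin p)) (hp : 0 < p) (t : ℕ) : Fin p :=
  σ (t / p) ⟨t % p, Nat.mod_lt t hp⟩

/-! ### An implementation with an operation count

The input is given by lists of the positions of the nonzero entries of rows and columns and by a list
of the vertices of every block. Besides `x`, the implementation stores the row and column sums of the
current scaling, the sum of its entries and its `ℓ₁` imbalance. Every arithmetic operation on real
numbers (including `exp`, `log`, `√` and `|·|`), every comparison of real numbers and every random draw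
of a block costs one unit. -/

/-- A value together with the number of operations spent on it. -/
structure Timed (α : Type) where
  val : α
  ops : ℕ

instance : Monad Timed where
  pure a := ⟨a, 0⟩
  bind s f := ⟨(f s.val).val, s.ops + (f s.val).ops⟩

/-- One operation with result `a`. -/
def op {α : Type} (a : α) : Timed α := ⟨a, 1⟩

/-- The data stored by the implementation. -/
structure State (n : ℕ) where
  x : Fin n → ℝ
  row : Fin n → ℝ
  col : Fin n → ℝ
  tot : ℝ
  imb : ℝ

/-- Replace `row i` by `row i + δ` and adjust the stored imbalance. -/
def addRow {n : ℕ} (i : Fin n) (δ : ℝ) (s : State n) : Timed (State n) := do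
  let y ← op (s.row i + δ)
  let u ← op (s.row i - s.col i)
  let u' ← op |u|
  let v ← op (y - s.col i)
  let v' ← op |v|
  let w ← op (s.imb - u')
  let w' ← op (w + v')
  return { s with row := Function.update s.row i y, imb := w' }

/-- Replace `col j` by `col j + δ` and adjust the stored imbalance. -/
def addCol {n : ℕ} (j : Fin n) (δ : ℝ) (s : State n) : Timed (State n) := do
  let y ← op (s.col j + δ)
  let u ← op (s.row j - s.col j)
  let u' ← op |u|
  let v ← op (s.row j - y)
  let v' ← op |v|
  let w ← op (s.imb - u')
  let w' ← op (w + v')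
  return { s with col := Function.update s.col j y, imb := w' }

/-- Adjust the stored sums when the entry at `(i, j)` of the current scaling changes by `δ`. -/
def addEntry {n : ℕ} (i j : Fin n) (δ : ℝ) (s : State n) : Timed (State n) := do
  let s ← addRow i δ s
  let s ← addCol j δ s
  let T ← op (s.tot + δ)
  return { s with tot := T }

/-- Compute `e^(a - b) * k`. -/
def scaledEntry (a b k : ℝ) : Timed ℝ := do
  let z ← op (a - b)
  let e ← op (Real.exp z)
  op (e * k)

/-- Positions of the nonzero off-diagonal entries of row `k`. -/
def outNbrs {n : ℕ} (K : Matrix (Fin n) (Fin n) ℝ) (k : Fin n) : List (Fin n) :=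
  (Finset.univ.filter fun j => j ≠ k ∧ K k j ≠ 0).toList

/-- Positions of the nonzero off-diagonal entries of column `k`. -/
def inNbrs {n : ℕ} (K : Matrix (Fin n) (Fin n) ℝ) (k : Fin n) : List (Fin n) :=
  (Finset.univ.filter fun j => j ≠ k ∧ K j k ≠ 0).toList

/-- The vertices of color `b`. -/
def blockList {n p : ℕ} (color : Fin n → Fin p) (b : Fin p) : List (Fin n) :=
  (Finset.univ.filter fun k => color k = b).toList

/-- Preprocessing: start with `x = 0` and add up the nonzero entries of `K`. -/
def initState {n : ℕ} (K : Matrix (Fin n) (Fin n) ℝ) : Timed (State n) :=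
  (Finset.univ.filter fun e : Fin n × Fin n => K e.1 e.2 ≠ 0).toList.foldlM
    (fun s e => addEntry e.1 e.2 (K e.1 e.2) s) ⟨0, 0, 0, 0, 0⟩

/-- Osborne update of coordinate `k`. -/
def updateVertex {n : ℕ} (K : Matrix (Fin n) (Fin n) ℝ) (s : State n) (k : Fin n) :
    Timed (State n) := do
  let lc ← op (Real.log (s.col k))
  let lr ← op (Real.log (s.row k))
  let g ← op (lc - lr)
  let h ← op (g / 2)
  let y ← op (s.x k + h)
  let s ← (outNbrs K k).foldlM (fun s j => do
    let old ← scaledEntry (s.x k) (s.x j) (K k j)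
    let new ← scaledEntry y (s.x j) (K k j)
    let δ ← op (new - old)
    addEntry k j δ s) s
  let s ← (inNbrs K k).foldlM (fun s j => do
    let old ← scaledEntry (s.x j) (s.x k) (K j k)
    let new ← scaledEntry (s.x j) y (K j k)
    let δ ← op (new - old)
    addEntry j k δ s) s
  return { s with x := Function.update s.x k y }

/-- One round on the block of color `b`. -/
def updateBlock {n p : ℕ} (K : Matrix (Fin n) (Fin n) ℝ) (color : Fin n → Fin p) (b : Fin p)
    (s : State n) : Timed (State n) :=
  (blockList color b).foldlM (updateVertex K) s

/-- The termination test. -/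
def terminationTest {n : ℕ} (ε : ℝ) (s : State n) : Timed Prop := do
  let z ← op (ε * s.tot)
  op (s.imb ≤ z)

/-- The imbalance of the block of color `b`, computed from the stored row and column sums. -/
def computeImbalance {n p : ℕ} (color : Fin n → Fin p) (s : State n) (b : Fin p) : Timed ℝ :=
  (blockList color b).foldlM (fun g k => do
    let y ← op (Real.sqrt (s.row k))
    let z ← op (Real.sqrt (s.col k))
    let w ← op (y - z)
    let w' ← op (w ^ 2)
    op (g + w')) 0

/-- The imbalances of all blocks. -/
def computeImbalances {n p : ℕ} (color : Fin n → Fin p) (s : State n) : Timed (Fin p → ℝ) :=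
  (List.finRange p).foldlM (fun g b => do
    let y ← computeImbalance color s b
    return Function.update g b y) 0

/-- Greedy choice: compute the imbalances of all blocks and select a maximal one by comparisons
(`p` operations); `sel` returns the position of a maximum and thereby breaks ties. -/
def greedyChoice {n p : ℕ} (color : Fin n → Fin p) (sel : ℕ → (Fin p → ℝ) → Fin p)
    (t : ℕ) (s : State n) : Timed (Fin p) := do
  let g ← computeImbalances color s
  ⟨sel t g, p⟩

/-- Prescribed (for instance randomly drawn) choice. -/
def drawnChoice {n p : ℕ} (ℓ : ℕ → Fin p) (t : ℕ) (_ : State n) : Timed (Fin p) := op (ℓ t)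

/-- The computation up to round `t`: each round tests for termination, chooses a block and updates it. -/
def exec {n p : ℕ} (K : Matrix (Fin n) (Fin n) ℝ) (ε : ℝ) (color : Fin n → Fin p)
    (choose : ℕ → State n → Timed (Fin p)) : ℕ → Timed (State n)
  | 0 => initState K
  | t + 1 => do
    let s ← exec K ε color choose t
    let _ ← terminationTest ε s
    let b ← choose t s
    updateBlock K color b s

/-- The termination test succeeds after `t` rounds. -/
def Stops {n p : ℕ} (K : Matrix (Fin n) (Fin n) ℝ) (ε : ℝ) (color : Fin n → Fin p)
    (choose : ℕ → State n → Timed (Fin p)) (t : ℕ) : Prop :=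
  (terminationTest ε (exec K ε color choose t).val).val

open Classical in
/-- Total work: all operations from the preprocessing up to the first successful termination test. -/
def work {n p : ℕ} (K : Matrix (Fin n) (Fin n) ℝ) (ε : ℝ) (color : Fin n → Fin p)
    (choose : ℕ → State n → Timed (Fin p)) : ℕ∞ :=
  if h : ∃ t, Stops K ε color choose t then
    (((exec K ε color choose (Nat.find h) >>= terminationTest ε).ops : ℕ) : ℕ∞)
  else ⊤

/-- The implementation runs Block Osborne with block sequence `ℓ`: it computes the same iterates and
stops exactly when the current scaling is `ε`-balanced. -/
def Implements {n p : ℕ} (K : Matrix (Fin n) (Fin n) ℝ) (ε : ℝ) (color : Fin n → Fin p)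
    (choose : ℕ → State n → Timed (Fin p)) (ℓ : ℕ → Fin p) : Prop :=
  ∀ t, (exec K ε color choose t).val.x = iterate K color ℓ t ∧
    (Stops K ε color choose t ↔ IsEpsBalanced ε (scaling K (iterate K color ℓ t)))

/-! ### Guarantees for random quantities -/

/-- `T = O(B)` with constant `C`, in expectation and with high probability (with exponential tails). -/
def BoundedInExpectationAndWHP {Ω : Type u} [MeasurableSpace Ω] (μ : MeasureTheory.Measure Ω)
    (T : Ω → ℕ∞) (C B : ℝ) : Prop :=
  ∫⁻ ω, ((T ω : ℕ∞) : ℝ≥0∞) ∂μ ≤ ENNReal.ofReal (C * B) ∧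
    ∀ δ : ℝ, 0 < δ → δ ≤ 1 / 2 →
      ENNReal.ofReal (1 - δ) ≤
        μ {ω | ((T ω : ℕ∞) : ℝ≥0∞) ≤ ENNReal.ofReal (C * (B * Real.log (1 / δ)))}

end BlockOsborne

end

/-!
Let `S x` be the sum of the entries of the scaling `A` of `K` by `x`, and `u k = √r_k(A) - √c_k(A)`.

*Progress.* Since the vertices of a block are pairwise nonadjacent, a block update acts independently
on them and decreases `S` by at least the block imbalance `∑ u k ^ 2` (`total_blockUpdate_le`). By
Cauchy–Schwarz the sum of all `u k ^ 2` is at least `δ² S / 4`, where `δ` is the relative `ℓ₁` imbalance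
(`sq_sum_abs_le`). So the largest block and a uniformly random block both make progress of at least
`1 / p` times `∑ u k ^ 2`. For a cycle in random order the corresponding factor is of order `1 / √p`
(`cycle_progress`): the vector `u` moves by at most the square root of the progress
(`sum_sq_vertexImbalance_sub_le`), and this change rarely hits the blocks updated soon afterwards,
since among the first `√p` blocks of a random order the later ones are a small random subset of the
blocks not yet updated.

*Potential.* The gap `V = log S x - inf log S` lies in `[0, log κ]`, and convexity of `log S` together
with `|x i - x j| ≤ d log κ` gives `V ≤ 2 d log κ · δ` (`gap_le_mul_imbalance`). Hence `V` decreases at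
rate at least of order `(ε + V / (2 d log κ))²`, and the concave function of `V` for which this becomes
unit speed is explicit: up to a factor, `V / (ε (ε + V / (2 d log κ)))`, which is `O(R)`
(`potential_le`). It therefore drops on average by at least `1` in every step that starts from an
unbalanced scaling (`sum_potential_le`). This settles the greedy variant.

*Randomness.* If a potential `W` with values in `[0, M]` drops on average by `1`, then
`(1 + W / M) exp (θ · cost)` is a supermartingale for `θ` of order `1 / (M · average cost)`, so the total
cost has bounded exponential moments on the scale `1 / θ`
(`boundedInExpectationAndWHP_of_potential`). With unit costs this bounds the number of rounds; with the
operation counts of the blocks, which add up to `O(m)` (`sum_blockCost_le`), it bounds the total work.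

*Implementation.* The stored sums are exactly those of the current scaling (`exec_spec`).
-/

noncomputable section

namespace BlockOsborne

/-! ### Diagonal scalings -/

section Scaling

variable {n p : ℕ}

/-- Nonnegative matrices without zero rows and columns. Balanceable matrices without zero rows are of
this kind, and this is what makes all logarithms in the updates genuine. -/
structure Admissible (K : Matrix (Fin n) (Fin n) ℝ) : Prop where
  nonneg : ∀ i j, 0 ≤ K i j
  row_ne : ∀ i, ∃ j, K i j ≠ 0
  col_ne : ∀ j, ∃ i, K i j ≠ 0

lemma scaling_apply (K : Matrix (Fin n) (Fin n) ℝ) (x : Fin n → ℝ) (i j : Fin n) :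
    scaling K x i j = K i j * Real.exp (x i - x j) := by
  rw [scaling, Matrix.mul_diagonal, Matrix.diagonal_mul, sub_eq_add_neg, Real.exp_add]
  ring

lemma scaling_add_apply (K : Matrix (Fin n) (Fin n) ℝ) (x η : Fin n → ℝ) (i j : Fin n) :
    scaling K (x + η) i j = scaling K x i j * Real.exp (η i - η j) := by
  rw [scaling_apply, scaling_apply, mul_assoc, ← Real.exp_add]
  congr 2
  simp only [Pi.add_apply]
  ring

lemma scaling_zero (K : Matrix (Fin n) (Fin n) ℝ) : scaling K 0 = K := by
  ext i j
  simp [scaling_apply]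

lemma scaling_eq_zero_iff {K : Matrix (Fin n) (Fin n) ℝ} {x : Fin n → ℝ} {i j : Fin n} :
    scaling K x i j = 0 ↔ K i j = 0 := by
  simp [scaling_apply, Real.exp_ne_zero]

lemma total_eq_sum_rowSum (A : Matrix (Fin n) (Fin n) ℝ) : total A = ∑ i, rowSum A i := rfl

lemma total_eq_sum_colSum (A : Matrix (Fin n) (Fin n) ℝ) : total A = ∑ j, colSum A j :=
  Finset.sum_comm

lemma sum_rowSum_sub_colSum (A : Matrix (Fin n) (Fin n) ℝ) :
    ∑ i, (rowSum A i - colSum A i) = 0 := by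
  rw [Finset.sum_sub_distrib, ← total_eq_sum_rowSum, ← total_eq_sum_colSum, sub_self]

lemma Admissible.of_balanceable {K : Matrix (Fin n) (Fin n) ℝ} (h0 : ∀ i j, 0 ≤ K i j)
    (hr : ∀ i, ∃ j, K i j ≠ 0) (hb : Balanceable K) : Admissible K := by
  refine ⟨h0, hr, fun j => ?_⟩
  obtain ⟨x, hx⟩ := hb
  by_contra! hj
  have hc : colSum (scaling K x) j = 0 :=
    Finset.sum_eq_zero fun i _ => scaling_eq_zero_iff.2 (hj i)
  rw [← hx, rowSum, Finset.sum_eq_zero_iff_of_nonneg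
    (fun i _ => by rw [scaling_apply]; exact mul_nonneg (h0 _ _) (Real.exp_pos _).le)] at hc
  obtain ⟨k, hk⟩ := hr j
  exact hk (scaling_eq_zero_iff.1 (hc k (Finset.mem_univ k)))

variable {K : Matrix (Fin n) (Fin n) ℝ}

namespace Admissible

lemma scaling (hK : Admissible K) (x : Fin n → ℝ) : Admissible (scaling K x) := by
  refine ⟨fun i j => ?_, fun i => ?_, fun j => ?_⟩
  · rw [scaling_apply]
    exact mul_nonneg (hK.nonneg i j) (Real.exp_pos _).le
  · exact (hK.row_ne i).imp fun j hj h => hj (scaling_eq_zero_iff.1 h)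
  · exact (hK.col_ne j).imp fun i hi h => hi (scaling_eq_zero_iff.1 h)

lemma rowSum_pos (hK : Admissible K) (i : Fin n) : 0 < rowSum K i := by
  obtain ⟨j, hj⟩ := hK.row_ne i
  exact Finset.sum_pos' (fun j _ => hK.nonneg i j)
    ⟨j, Finset.mem_univ j, lt_of_le_of_ne (hK.nonneg i j) (Ne.symm hj)⟩

lemma colSum_pos (hK : Admissible K) (j : Fin n) : 0 < colSum K j := by
  obtain ⟨i, hi⟩ := hK.col_ne j
  exact Finset.sum_pos' (fun i _ => hK.nonneg i j)
    ⟨i, Finset.mem_univ i, lt_of_le_of_ne (hK.nonneg i j) (Ne.symm hi)⟩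

lemma total_pos [NeZero n] (hK : Admissible K) : 0 < total K :=
  Finset.sum_pos (fun i _ => hK.rowSum_pos i) ⟨0, Finset.mem_univ _⟩

lemma entry_le_total (hK : Admissible K) (i j : Fin n) : K i j ≤ total K :=
  (Finset.single_le_sum (f := fun j => K i j) (fun j _ => hK.nonneg i j) (Finset.mem_univ j)).trans
    (Finset.single_le_sum (f := fun i => rowSum K i) (fun i _ => (hK.rowSum_pos i).le)
      (Finset.mem_univ i))

lemma sum_abs_le (hK : Admissible K) : ∑ i, |rowSum K i - colSum K i| ≤ 2 * total K := by
  calc ∑ i, |rowSum K i - colSum K i| ≤ ∑ i, (rowSum K i + colSum K i) := by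
        refine Finset.sum_le_sum fun i _ => abs_le.2 ⟨?_, ?_⟩ <;>
        linarith [hK.rowSum_pos i, hK.colSum_pos i]
    _ = 2 * total K := by
        rw [Finset.sum_add_distrib, ← total_eq_sum_rowSum, ← total_eq_sum_colSum, two_mul]

end Admissible

/-! ### Progress of a block update -/

/-- The signed imbalance `√r_k(A) - √c_k(A)` of a vertex. -/
def vertexImbalance (A : Matrix (Fin n) (Fin n) ℝ) (k : Fin n) : ℝ :=
  Real.sqrt (rowSum A k) - Real.sqrt (colSum A k)

/-- The increment of `x` in a block update. -/
def blockStep (K : Matrix (Fin n) (Fin n) ℝ) (color : Fin n → Fin p) (b : Fin p) (x : Fin n → ℝ) :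
    Fin n → ℝ := fun k =>
  if color k = b then
    (Real.log (colSum (scaling K x) k) - Real.log (rowSum (scaling K x) k)) / 2
  else 0

lemma blockUpdate_eq (K : Matrix (Fin n) (Fin n) ℝ) (color : Fin n → Fin p) (b : Fin p)
    (x : Fin n → ℝ) : blockUpdate K color b x = x + blockStep K color b x := by
  ext k
  simp only [blockUpdate, blockStep, Pi.add_apply]
  split_ifs <;> simp

lemma blockImbalance_eq (A : Matrix (Fin n) (Fin n) ℝ) (color : Fin n → Fin p) (b : Fin p) :
    blockImbalance A color b = ∑ k, if color k = b then vertexImbalance A k ^ 2 else 0 := by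
  rw [blockImbalance, Finset.sum_filter]
  rfl

lemma sum_ite_color (color : Fin n → Fin p) (f : Fin n → ℝ) :
    ∑ b, ∑ k, (if color k = b then f k else 0) = ∑ k, f k := by
  rw [Finset.sum_comm]
  simp

lemma sum_blockImbalance (A : Matrix (Fin n) (Fin n) ℝ) (color : Fin n → Fin p) :
    ∑ b, blockImbalance A color b = ∑ k, vertexImbalance A k ^ 2 := by
  simp_rw [blockImbalance_eq]
  exact sum_ite_color color _

lemma blockImbalance_nonneg (A : Matrix (Fin n) (Fin n) ℝ) (color : Fin n → Fin p) (b : Fin p) :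
    0 ≤ blockImbalance A color b := Finset.sum_nonneg fun _ _ => sq_nonneg _

/-- In a block update the entry at `(i, j)` is multiplied by `exp (η i - η j)`, where `η i = 0` or
`η j = 0` off the diagonal unless the entry is zero. So a sum over the entries of a function of
`η i - η j` splits into contributions of the rows and of the columns of the block. The diagonal only
contributes to the inequality. -/
lemma sum_blockStep_le (hK : Admissible K) {color : Fin n → Fin p} (hc : IsColoring K color)
    (b : Fin p) (x : Fin n → ℝ) (h : ℝ → ℝ) (f g : ℝ → ℝ) (h0 : h 0 = 0) (f0 : f 0 = 0)
    (g0 : g 0 = 0) (hf : ∀ u, h u = f u) (hg : ∀ u, h (-u) = g u) (hfg : ∀ u, 0 ≤ f u + g u) :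
    ∑ i, ∑ j, scaling K x i j * h (blockStep K color b x i - blockStep K color b x j) ≤
      ∑ k, if color k = b then
        (rowSum (scaling K x) k * f (blockStep K color b x k) +
          colSum (scaling K x) k * g (blockStep K color b x k)) else 0 := by
  set A := scaling K x with hA
  set η := blockStep K color b x with hη
  have hη0 : ∀ k, color k ≠ b → η k = 0 := fun k hk => by simp [hη, blockStep, hk]
  have hpt : ∀ i j, A i j * h (η i - η j) ≤ A i j * (f (η i) + g (η j)) := by
    intro i j
    by_cases hij : i = j
    · subst hij
      rw [sub_self, h0, mul_zero]
      exact mul_nonneg ((hK.scaling x).nonneg i i) (hfg _)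
    by_cases hi : color i = b
    · by_cases hj : color j = b
      · have : A i j = 0 := scaling_eq_zero_iff.2 (hc.2 i j hij (hi.trans hj.symm))
        simp [this]
      · rw [hη0 j hj, g0, sub_zero, hf, add_zero]
    · rw [hη0 i hi, f0, zero_sub, hg, zero_add]
  refine (Finset.sum_le_sum fun i _ => Finset.sum_le_sum fun j _ => hpt i j).trans (le_of_eq ?_)
  simp_rw [mul_add, Finset.sum_add_distrib]
  rw [Finset.sum_comm (f := fun i j => A i j * g (η j))]
  simp_rw [← Finset.sum_mul]
  rw [← Finset.sum_add_distrib]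
  refine Finset.sum_congr rfl fun k _ => ?_
  split_ifs with hk
  · rfl
  · simp [hη0 k hk, f0, g0]

lemma exp_blockStep (hK : Admissible K) {color : Fin n → Fin p} {b : Fin p} (x : Fin n → ℝ)
    {k : Fin n} (hk : color k = b) :
    Real.exp (blockStep K color b x k) =
      Real.sqrt (colSum (scaling K x) k) / Real.sqrt (rowSum (scaling K x) k) := by
  have hr := (hK.scaling x).rowSum_pos k
  have hc := (hK.scaling x).colSum_pos k
  rw [blockStep, if_pos hk, sub_div, Real.exp_sub, ← Real.log_sqrt hc.le, ← Real.log_sqrt hr.le,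
    Real.exp_log (Real.sqrt_pos.2 hc), Real.exp_log (Real.sqrt_pos.2 hr)]

/-- A block update decreases the sum of the entries by at least the imbalance of the block. Diagonal
entries of `K` are not changed by the update, and only help. -/
lemma total_blockUpdate_le (hK : Admissible K) {color : Fin n → Fin p} (hc : IsColoring K color)
    (b : Fin p) (x : Fin n → ℝ) :
    total (scaling K (blockUpdate K color b x)) + blockImbalance (scaling K x) color b ≤
      total (scaling K x) := by
  have key := sum_blockStep_le hK hc b x (fun u => Real.exp u - 1) (fun u => Real.exp u - 1)
    (fun u => Real.exp (-u) - 1) (by simp) (by simp) (by simp) (fun _ => rfl) (fun _ => rfl)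
    (fun u => by linarith [Real.add_one_le_exp u, Real.add_one_le_exp (-u)])
  have h1 : total (scaling K (blockUpdate K color b x)) - total (scaling K x) =
      ∑ i, ∑ j, scaling K x i j *
        (Real.exp (blockStep K color b x i - blockStep K color b x j) - 1) := by
    simp only [total, blockUpdate_eq, scaling_add_apply, mul_sub, mul_one, Finset.sum_sub_distrib]
  have h2 : (∑ k, if color k = b then
        (rowSum (scaling K x) k * (Real.exp (blockStep K color b x k) - 1) +
          colSum (scaling K x) k * (Real.exp (-blockStep K color b x k) - 1)) else 0) =
      -blockImbalance (scaling K x) color b := by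
    rw [blockImbalance_eq, ← Finset.sum_neg_distrib]
    refine Finset.sum_congr rfl fun k _ => ?_
    split_ifs with hk
    · have hr := (hK.scaling x).rowSum_pos k
      have hcl := (hK.scaling x).colSum_pos k
      have aux : ∀ ρ γ : ℝ, 0 < ρ → 0 < γ →
          ρ ^ 2 * (γ / ρ - 1) + γ ^ 2 * ((γ / ρ)⁻¹ - 1) = -(ρ - γ) ^ 2 := by
        intro ρ γ hρ hγ
        field_simp
        ring
      have h := aux _ _ (Real.sqrt_pos.2 hr) (Real.sqrt_pos.2 hcl)
      rw [Real.sq_sqrt hr.le, Real.sq_sqrt hcl.le] at h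
      rw [Real.exp_neg, exp_blockStep hK x hk, h, vertexImbalance]
    · simp
  simp only [h2] at key
  linarith

/-- Reverse triangle inequality for the Euclidean norms of the entrywise square roots. -/
lemma sum_sq_sqrt_sub_le {ι : Type*} [Fintype ι] (f g : ι → ℝ) (hf : ∀ i, 0 ≤ f i)
    (hg : ∀ i, 0 ≤ g i) :
    (Real.sqrt (∑ i, f i) - Real.sqrt (∑ i, g i)) ^ 2 ≤
      ∑ i, (Real.sqrt (f i) - Real.sqrt (g i)) ^ 2 := by
  have h := Real.sum_sqrt_mul_sqrt_le Finset.univ hf hg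
  have hF := Finset.sum_nonneg fun i (_ : i ∈ Finset.univ) => hf i
  have hG := Finset.sum_nonneg fun i (_ : i ∈ Finset.univ) => hg i
  have e : ∀ i, (Real.sqrt (f i) - Real.sqrt (g i)) ^ 2 =
      f i + g i - 2 * (Real.sqrt (f i) * Real.sqrt (g i)) := fun i => by
    rw [sub_sq, Real.sq_sqrt (hf i), Real.sq_sqrt (hg i)]; ring
  simp_rw [e]
  rw [sub_sq, Real.sq_sqrt hF, Real.sq_sqrt hG, Finset.sum_sub_distrib, Finset.sum_add_distrib,
    ← Finset.mul_sum]
  linarith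

/-- A block update moves the matrix by at most twice the block imbalance in squared Hellinger
distance. -/
lemma hellinger_blockUpdate_le (hK : Admissible K) {color : Fin n → Fin p}
    (hc : IsColoring K color) (b : Fin p) (x : Fin n → ℝ) :
    ∑ i, ∑ j, (Real.sqrt (scaling K (blockUpdate K color b x) i j) -
        Real.sqrt (scaling K x i j)) ^ 2 ≤
      2 * blockImbalance (scaling K x) color b := by
  have key := sum_blockStep_le hK hc b x (fun u => (Real.exp (u / 2) - 1) ^ 2)
    (fun u => (Real.exp (u / 2) - 1) ^ 2) (fun u => (Real.exp (-u / 2) - 1) ^ 2)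
    (by simp) (by simp) (by simp) (fun _ => rfl) (fun _ => rfl) (fun u => by positivity)
  have h1 : ∀ i j, (Real.sqrt (scaling K (blockUpdate K color b x) i j) -
        Real.sqrt (scaling K x i j)) ^ 2 = scaling K x i j *
        (Real.exp ((blockStep K color b x i - blockStep K color b x j) / 2) - 1) ^ 2 := by
    intro i j
    have hA := (hK.scaling x).nonneg i j
    rw [blockUpdate_eq, scaling_add_apply, Real.sqrt_mul hA, Real.exp_half, ← mul_sub_one, mul_pow,
      Real.sq_sqrt hA]
  simp_rw [h1]
  refine key.trans ?_
  rw [blockImbalance_eq, Finset.mul_sum]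
  refine Finset.sum_le_sum fun k _ => ?_
  split_ifs with hk
  · -- with `z = exp (η/2)`: `ρ² (z - 1)² ≤ ρ² (z² - 1)² = (γ - ρ)²`, and likewise for the column
    have hr := (hK.scaling x).rowSum_pos k
    have hcl := (hK.scaling x).colSum_pos k
    have aux : ∀ ρ γ η : ℝ, 0 < ρ → Real.exp η = γ / ρ →
        ρ ^ 2 * (Real.exp (η / 2) - 1) ^ 2 ≤ (ρ - γ) ^ 2 := by
      intro ρ γ η hρ h
      have hz := Real.exp_pos (η / 2)
      have h2 : γ = ρ * Real.exp (η / 2) ^ 2 := by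
        rw [← Real.exp_nat_mul, Nat.cast_two, mul_div_cancel₀ η two_ne_zero, h]
        field_simp
      set z := Real.exp (η / 2)
      have : (ρ - γ) ^ 2 = ρ ^ 2 * (z - 1) ^ 2 * (1 + z) ^ 2 := by rw [h2]; ring
      rw [this]
      exact le_mul_of_one_le_right (by positivity) (by nlinarith)
    have a1 := aux _ _ _ (Real.sqrt_pos.2 hr) (exp_blockStep hK x hk)
    have a2 := aux (Real.sqrt (colSum (scaling K x) k)) (Real.sqrt (rowSum (scaling K x) k))
      (-blockStep K color b x k) (Real.sqrt_pos.2 hcl)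
      (by rw [Real.exp_neg, exp_blockStep hK x hk, inv_div])
    rw [Real.sq_sqrt hr.le] at a1
    rw [Real.sq_sqrt hcl.le] at a2
    rw [vertexImbalance]
    nlinarith [a1, a2]
  · simp

/-- A block update moves the vector of signed vertex imbalances by at most a constant times the
square root of the block imbalance. -/
lemma sum_sq_vertexImbalance_sub_le (hK : Admissible K) {color : Fin n → Fin p}
    (hc : IsColoring K color) (b : Fin p) (x : Fin n → ℝ) :
    ∑ k, (vertexImbalance (scaling K (blockUpdate K color b x)) k -
        vertexImbalance (scaling K x) k) ^ 2 ≤ 8 * blockImbalance (scaling K x) color b := by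
  set A := scaling K x with hA
  set B := scaling K (blockUpdate K color b x) with hB
  have hA0 := (hK.scaling x).nonneg
  have hB0 := (hK.scaling (blockUpdate K color b x)).nonneg
  have hH := hellinger_blockUpdate_le hK hc b x
  have h1 : ∑ k, (Real.sqrt (rowSum B k) - Real.sqrt (rowSum A k)) ^ 2 ≤
      ∑ i, ∑ j, (Real.sqrt (B i j) - Real.sqrt (A i j)) ^ 2 :=
    Finset.sum_le_sum fun k _ => sum_sq_sqrt_sub_le _ _ (hB0 k) (hA0 k)
  have h2 : ∑ k, (Real.sqrt (colSum B k) - Real.sqrt (colSum A k)) ^ 2 ≤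
      ∑ i, ∑ j, (Real.sqrt (B i j) - Real.sqrt (A i j)) ^ 2 := by
    rw [Finset.sum_comm]
    exact Finset.sum_le_sum fun k _ =>
      sum_sq_sqrt_sub_le _ _ (fun i => hB0 i k) (fun i => hA0 i k)
  have h3 : ∑ k, (vertexImbalance B k - vertexImbalance A k) ^ 2 ≤
      2 * ∑ k, (Real.sqrt (rowSum B k) - Real.sqrt (rowSum A k)) ^ 2 +
      2 * ∑ k, (Real.sqrt (colSum B k) - Real.sqrt (colSum A k)) ^ 2 := by
    rw [Finset.mul_sum, Finset.mul_sum, ← Finset.sum_add_distrib]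
    refine Finset.sum_le_sum fun k _ => ?_
    rw [vertexImbalance, vertexImbalance]
    nlinarith [sq_nonneg ((Real.sqrt (rowSum B k) - Real.sqrt (rowSum A k)) +
      (Real.sqrt (colSum B k) - Real.sqrt (colSum A k)))]
  linarith

/-- Cauchy–Schwarz: the `ℓ₁` imbalance is controlled by the vertex imbalances. -/
lemma sq_sum_abs_le (hK : Admissible K) :
    (∑ i, |rowSum K i - colSum K i|) ^ 2 ≤ 4 * total K * ∑ k, vertexImbalance K k ^ 2 := by
  have h1 : ∀ i, |rowSum K i - colSum K i| =
      |vertexImbalance K i| * (Real.sqrt (rowSum K i) + Real.sqrt (colSum K i)) := by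
    intro i
    have hr := (hK.rowSum_pos i).le
    have hc := (hK.colSum_pos i).le
    rw [← abs_of_nonneg (add_nonneg (Real.sqrt_nonneg (rowSum K i)) (Real.sqrt_nonneg (colSum K i))),
      ← abs_mul, vertexImbalance]
    congr 1
    nth_rewrite 1 [← Real.sq_sqrt hr, ← Real.sq_sqrt hc]
    ring
  simp_rw [h1]
  refine (Finset.sum_mul_sq_le_sq_mul_sq _ _ _).trans ?_
  simp_rw [sq_abs]
  rw [mul_comm]
  refine mul_le_mul_of_nonneg_right ?_ (Finset.sum_nonneg fun _ _ => sq_nonneg _)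
  calc ∑ i, (Real.sqrt (rowSum K i) + Real.sqrt (colSum K i)) ^ 2
      ≤ ∑ i, (2 * rowSum K i + 2 * colSum K i) := by
        refine Finset.sum_le_sum fun i _ => ?_
        nlinarith [Real.sq_sqrt (hK.rowSum_pos i).le, Real.sq_sqrt (hK.colSum_pos i).le,
          sq_nonneg (Real.sqrt (rowSum K i) - Real.sqrt (colSum K i))]
    _ = 4 * total K := by
        rw [Finset.sum_add_distrib, ← Finset.mul_sum, ← Finset.mul_sum, ← total_eq_sum_rowSum,
          ← total_eq_sum_colSum]
        ring

end Scaling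

/-! ### The gap to the optimum -/

section Gap

variable {n p : ℕ} {K : Matrix (Fin n) (Fin n) ℝ}

/-- Convexity of `x ↦ log (∑ entries of the scaling by x)`, whose gradient is `(r - c) / total`. -/
lemma log_total_add_le [NeZero n] (hK : Admissible K) (x y : Fin n → ℝ) :
    Real.log (total (scaling K x)) +
        (∑ i, (rowSum (scaling K x) i - colSum (scaling K x) i) * (y i - x i)) /
          total (scaling K x) ≤
      Real.log (total (scaling K y)) := by
  set A := scaling K x with hA
  set z := y - x with hz
  have hy : y = x + z := by simp [hz]
  have hS : 0 < total A := (hK.scaling x).total_pos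
  have hsum : ∑ i, (rowSum A i - colSum A i) * (y i - x i) = ∑ i, ∑ j, A i j * (z i - z j) := by
    simp_rw [mul_sub (A _ _), Finset.sum_sub_distrib]
    rw [Finset.sum_comm (f := fun i j => A i j * z j)]
    simp_rw [← Finset.sum_mul, ← Finset.sum_sub_distrib, ← sub_mul]
    rfl
  rw [hsum]
  set m := (∑ i, ∑ j, A i j * (z i - z j)) / total A with hm
  have hmS : ∑ i, ∑ j, A i j * (z i - z j) = m * total A := by rw [hm]; field_simp
  have key : Real.exp m * total A ≤ total (scaling K y) := by
    have h1 : ∀ i j, Real.exp m * (A i j * (1 - m) + A i j * (z i - z j)) ≤ scaling K y i j := by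
      intro i j
      rw [hy, scaling_add_apply]
      have e : Real.exp (z i - z j) = Real.exp m * Real.exp (z i - z j - m) := by
        rw [← Real.exp_add]; congr 1; ring
      rw [e]
      have := mul_le_mul_of_nonneg_left (Real.add_one_le_exp (z i - z j - m))
        (mul_nonneg ((hK.scaling x).nonneg i j) (Real.exp_pos m).le)
      linarith
    calc Real.exp m * total A
        = ∑ i, ∑ j, Real.exp m * (A i j * (1 - m) + A i j * (z i - z j)) := by
          simp_rw [← Finset.mul_sum, Finset.sum_add_distrib, ← Finset.sum_mul]
          rw [hmS, show ∑ i, ∑ j, A i j = total A from rfl]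
          ring
      _ ≤ _ := Finset.sum_le_sum fun i _ => Finset.sum_le_sum fun j _ => h1 i j
  have := Real.log_le_log (by positivity) key
  rw [Real.log_mul (Real.exp_pos _).ne' hS.ne', Real.log_exp] at this
  linarith

lemma minEntry_spec [NeZero n] (hK : Admissible K) :
    0 < minEntry K ∧ ∀ i j, K i j ≠ 0 → minEntry K ≤ K i j := by
  have hfin : {a : ℝ | a ≠ 0 ∧ ∃ i j, K i j = a}.Finite := by
    refine (Set.finite_range fun e : Fin n × Fin n => K e.1 e.2).subset ?_
    rintro a ⟨-, i, j, h⟩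
    exact ⟨(i, j), h⟩
  obtain ⟨j, hj⟩ := hK.row_ne 0
  have hne : {a : ℝ | a ≠ 0 ∧ ∃ i j, K i j = a}.Nonempty := ⟨K 0 j, hj, 0, j, rfl⟩
  refine ⟨?_, fun i j h => csInf_le hfin.bddBelow ⟨h, i, j, rfl⟩⟩
  obtain ⟨h, i', j', h'⟩ := hne.csInf_mem hfin
  have := hK.nonneg i' j'
  rw [h'] at this
  exact lt_of_le_of_ne this (Ne.symm h)

/-- The entries in the row of the largest coordinate of `x` do not decrease under the scaling. -/
lemma minEntry_le_total_scaling [NeZero n] (hK : Admissible K) (x : Fin n → ℝ) :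
    minEntry K ≤ total (scaling K x) := by
  obtain ⟨i, hi⟩ := Finite.exists_max x
  obtain ⟨j, hj⟩ := hK.row_ne i
  refine le_trans ?_ ((hK.scaling x).entry_le_total i j)
  rw [scaling_apply]
  have h1 : 1 ≤ Real.exp (x i - x j) := Real.one_le_exp (by linarith [hi j])
  exact ((minEntry_spec hK).2 i j hj).trans (le_mul_of_one_le_right (hK.nonneg i j) h1)

/-- The suboptimality of `x` for the logarithm of the sum of the entries, relative to `xs`. -/
def gap (K : Matrix (Fin n) (Fin n) ℝ) (xs x : Fin n → ℝ) : ℝ :=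
  Real.log (total (scaling K x)) - Real.log (total (scaling K xs))

/-- The relative `ℓ₁` imbalance. -/
def imbalance (A : Matrix (Fin n) (Fin n) ℝ) : ℝ := (∑ i, |rowSum A i - colSum A i|) / total A

lemma gap_nonneg [NeZero n] (hK : Admissible K) {xs : Fin n → ℝ}
    (hxs : rowSum (scaling K xs) = colSum (scaling K xs)) (x : Fin n → ℝ) : 0 ≤ gap K xs x := by
  have := log_total_add_le hK xs x
  simp only [hxs, sub_self, zero_mul, Finset.sum_const_zero, zero_div, add_zero] at this
  exact sub_nonneg.2 this

lemma gap_le_log_condNumber [NeZero n] (hK : Admissible K) (xs : Fin n → ℝ) {x : Fin n → ℝ}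
    (hx : total (scaling K x) ≤ total K) : gap K xs x ≤ Real.log (condNumber K) := by
  have hm := (minEntry_spec hK).1
  rw [gap, condNumber, Real.log_div hK.total_pos.ne' hm.ne']
  exact sub_le_sub (Real.log_le_log (hK.scaling x).total_pos hx)
    (Real.log_le_log hm (minEntry_le_total_scaling hK xs))

lemma sub_le_mul_log_of_hasWalk [NeZero n] (hK : Admissible K) {x : Fin n → ℝ}
    (hx : total (scaling K x) ≤ total K) :
    ∀ (k : ℕ) (i j : Fin n), HasWalk K k i j → x i - x j ≤ k * Real.log (condNumber K)
  | 0, i, j, h => by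
    obtain rfl : i = j := h
    simp
  | k + 1, i, j, ⟨l, hl, h⟩ => by
    have ih := sub_le_mul_log_of_hasWalk hK hx k l j h
    have hm := (minEntry_spec hK).1
    have h1 : minEntry K * Real.exp (x i - x l) ≤ total K :=
      (mul_le_mul_of_nonneg_right ((minEntry_spec hK).2 i l hl) (Real.exp_pos _).le).trans
        (by rw [← scaling_apply]; exact ((hK.scaling x).entry_le_total i l).trans hx)
    have h2 : x i - x l ≤ Real.log (condNumber K) := by
      rw [condNumber, Real.le_log_iff_exp_le (div_pos hK.total_pos hm), le_div_iff₀ hm]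
      linarith
    push_cast
    linarith

lemma exists_walk_le_diameter (h : diameter K ≠ ⊤) (i j : Fin n) :
    ∃ k : ℕ, k ≤ (diameter K).toNat ∧ HasWalk K k i j := by
  have h1 : graphDist K i j ≤ diameter K :=
    (le_iSup (fun j => graphDist K i j) j).trans (le_iSup (fun i => ⨆ j, graphDist K i j) i)
  obtain ⟨d, hd⟩ := ENat.ne_top_iff_exists.1 h
  have h2 : graphDist K i j < ((d + 1 : ℕ) : ℕ∞) := by
    rw [← hd] at h1
    exact h1.trans_lt (by exact_mod_cast Nat.lt_succ_self d)
  simp only [graphDist, iInf_lt_iff] at h2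
  obtain ⟨k, hk, hlt⟩ := h2
  refine ⟨k, ?_, hk⟩
  rw [← hd, ENat.toNat_natCast]
  exact Nat.lt_succ_iff.1 (by exact_mod_cast hlt)

lemma abs_sub_le_diameter_mul_log [NeZero n] (hK : Admissible K) (h : diameter K ≠ ⊤)
    (hL : 0 ≤ Real.log (condNumber K)) {x : Fin n → ℝ} (hx : total (scaling K x) ≤ total K)
    (i j : Fin n) : |x i - x j| ≤ (diameter K).toNat * Real.log (condNumber K) := by
  have aux : ∀ i j, x i - x j ≤ (diameter K).toNat * Real.log (condNumber K) := fun i j => by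
    obtain ⟨k, hk, hw⟩ := exists_walk_le_diameter h i j
    exact (sub_le_mul_log_of_hasWalk hK hx k i j hw).trans (by gcongr)
  exact abs_le.2 ⟨by linarith [aux j i], aux i j⟩

lemma gap_le_mul_imbalance [NeZero n] (hK : Admissible K) (h : diameter K ≠ ⊤)
    (hL : 0 ≤ Real.log (condNumber K)) {xs x : Fin n → ℝ}
    (hxs : total (scaling K xs) ≤ total K) (hx : total (scaling K x) ≤ total K) :
    gap K xs x ≤
      2 * (diameter K).toNat * Real.log (condNumber K) * imbalance (scaling K x) := by
  have hc := log_total_add_le hK x xs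
  have hS : 0 < total (scaling K x) := (hK.scaling x).total_pos
  set A := scaling K x with hA
  set B := 2 * (diameter K).toNat * Real.log (condNumber K) with hB
  -- the row and column sums have the same total, so a constant may be subtracted from `xs - x`
  have h0 : ∑ i, (rowSum A i - colSum A i) * (xs i - x i) =
      ∑ i, (rowSum A i - colSum A i) * ((xs i - xs 0) - (x i - x 0)) := by
    have : ∑ i, (rowSum A i - colSum A i) * (xs 0 - x 0) = 0 := by
      rw [← Finset.sum_mul, sum_rowSum_sub_colSum, zero_mul]
    rw [← sub_zero (∑ i, (rowSum A i - colSum A i) * (xs i - x i)), ← this,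
      ← Finset.sum_sub_distrib]
    exact Finset.sum_congr rfl fun i _ => by ring
  have h1 : -(B * ∑ i, |rowSum A i - colSum A i|) ≤
      ∑ i, (rowSum A i - colSum A i) * (xs i - x i) := by
    rw [h0, Finset.mul_sum, ← Finset.sum_neg_distrib]
    refine Finset.sum_le_sum fun i _ => ?_
    have h2 : |(xs i - xs 0) - (x i - x 0)| ≤ B := by
      refine (abs_sub _ _).trans ?_
      have a1 := abs_sub_le_diameter_mul_log hK h hL hxs i 0
      have a2 := abs_sub_le_diameter_mul_log hK h hL hx i 0
      rw [hB]
      linarith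
    have h3 := neg_abs_le ((rowSum A i - colSum A i) * ((xs i - xs 0) - (x i - x 0)))
    rw [abs_mul] at h3
    nlinarith [mul_le_mul_of_nonneg_left h2 (abs_nonneg (rowSum A i - colSum A i))]
  have h4 : -(B * imbalance A) ≤
      (∑ i, (rowSum A i - colSum A i) * (xs i - x i)) / total A := by
    rw [imbalance, ← mul_div_assoc, ← neg_div]
    exact div_le_div_of_nonneg_right h1 hS.le
  rw [gap]
  linarith

/-- The reciprocal of the factor in the estimate of the gap by the imbalance; it vanishes if the
diameter is infinite. -/
def gapSlope (K : Matrix (Fin n) (Fin n) ℝ) : ℝ :=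
  if diameter K = ⊤ then 0 else 1 / (2 * (diameter K).toNat * Real.log (condNumber K))

lemma two_le_condNumber (hn : 2 ≤ n) (hK : Admissible K) : 2 ≤ condNumber K := by
  have : NeZero n := ⟨by lia⟩
  have hm := minEntry_spec hK
  rw [condNumber, le_div_iff₀ hm.1]
  have h1 : ∀ i, minEntry K ≤ rowSum K i := fun i => by
    obtain ⟨j, hj⟩ := hK.row_ne i
    exact (hm.2 i j hj).trans
      (Finset.single_le_sum (f := fun j => K i j) (fun j _ => hK.nonneg i j) (Finset.mem_univ j))
  calc 2 * minEntry K ≤ n * minEntry K := by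
        have : (2 : ℝ) ≤ n := by exact_mod_cast hn
        exact mul_le_mul_of_nonneg_right this hm.1.le
    _ = ∑ _i : Fin n, minEntry K := by simp
    _ ≤ total K := Finset.sum_le_sum fun i _ => h1 i

lemma log_condNumber_ge (hn : 2 ≤ n) (hK : Admissible K) : 1 / 2 ≤ Real.log (condNumber K) := by
  have := Real.log_le_log two_pos (two_le_condNumber hn hK)
  linarith [Real.log_two_gt_d9]

lemma one_le_diameter (hn : 2 ≤ n) (K : Matrix (Fin n) (Fin n) ℝ) : 1 ≤ diameter K := by
  have h1 : graphDist K ⟨0, by lia⟩ ⟨1, by lia⟩ ≤ diameter K :=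
    (le_iSup (fun j => graphDist K _ j) _).trans (le_iSup (fun i => ⨆ j, graphDist K i j) _)
  refine le_trans ?_ h1
  refine le_iInf₂ fun k hk => ?_
  rcases k with _ | k
  · simp [HasWalk] at hk
  · exact_mod_cast Nat.le_add_left 1 k

lemma one_le_toNat_diameter (hn : 2 ≤ n) (h : diameter K ≠ ⊤) :
    (1 : ℝ) ≤ (diameter K).toNat := by
  have h1 := one_le_diameter hn K
  obtain ⟨d, hd⟩ := ENat.ne_top_iff_exists.1 h
  rw [← hd] at h1 ⊢
  rw [ENat.toNat_natCast]
  exact_mod_cast h1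

lemma baseRate_eq_of_top (h : diameter K = ⊤) {ε : ℝ} (hε : 0 < ε) :
    baseRate K ε = 1 / ε * (1 / ε) * Real.log (condNumber K) := by
  rw [baseRate, h]
  have : (((⊤ : ℕ∞) : ℝ≥0∞)) = ⊤ := rfl
  rw [this, min_eq_left le_top, ENNReal.toReal_ofReal (by positivity)]

lemma baseRate_eq_of_ne_top (h : diameter K ≠ ⊤) {ε : ℝ} (hε : 0 < ε) :
    baseRate K ε = 1 / ε * min (1 / ε) (diameter K).toNat * Real.log (condNumber K) := by
  obtain ⟨d, hd⟩ := ENat.ne_top_iff_exists.1 h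
  rw [baseRate, ← hd, ENat.toNat_natCast]
  have : (((d : ℕ∞) : ℝ≥0∞)) = ENNReal.ofReal (d : ℝ) := by simp
  rw [this, ← ENNReal.ofReal_min, ENNReal.toReal_ofReal (by positivity)]

lemma baseRate_ge (hn : 2 ≤ n) (hK : Admissible K) {ε : ℝ} (hε : 0 < ε) (hε2 : ε ≤ 2) :
    1 / 8 ≤ baseRate K ε := by
  have hL := log_condNumber_ge hn hK
  have he : 1 / 2 ≤ 1 / ε := one_div_le_one_div_of_le hε hε2
  by_cases h : diameter K = ⊤
  · rw [baseRate_eq_of_top h hε]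
    calc (1 : ℝ) / 8 = 1 / 2 * (1 / 2) * (1 / 2) := by norm_num
      _ ≤ _ := by gcongr
  · rw [baseRate_eq_of_ne_top h hε]
    have hmin : 1 / 2 ≤ min (1 / ε) ((diameter K).toNat : ℝ) :=
      le_min he (by linarith [one_le_toNat_diameter hn h])
    calc (1 : ℝ) / 8 = 1 / 2 * (1 / 2) * (1 / 2) := by norm_num
      _ ≤ _ := by gcongr

lemma gapSlope_nonneg (hn : 2 ≤ n) (hK : Admissible K) : 0 ≤ gapSlope K := by
  have hL := log_condNumber_ge hn hK
  rw [gapSlope]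
  split_ifs
  · exact le_rfl
  · have : 0 ≤ Real.log (condNumber K) := by linarith
    positivity

lemma gapSlope_mul_gap_le (hn : 2 ≤ n) (hK : Admissible K) {xs x : Fin n → ℝ}
    (hxs : total (scaling K xs) ≤ total K) (hx : total (scaling K x) ≤ total K) :
    gapSlope K * gap K xs x ≤ imbalance (scaling K x) := by
  have : NeZero n := ⟨by lia⟩
  have hL := log_condNumber_ge hn hK
  rw [gapSlope]
  split_ifs with h
  · rw [zero_mul]
    exact div_nonneg (Finset.sum_nonneg fun _ _ => abs_nonneg _) (hK.scaling x).total_pos.le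
  · have hd := one_le_toNat_diameter hn h
    have h1 := gap_le_mul_imbalance hK h (by linarith) hxs hx
    rw [one_div_mul_eq_div, div_le_iff₀ (by nlinarith), mul_comm (imbalance _)]
    exact h1

/-! ### The potential -/

/-- A concave function of the gap `V`. With decrease of order `(ε + lam * V)²` per round, the gap
follows `V' = -(ε + lam * V)²`, and the time to reach `0` from `V` is `V / (ε * (ε + lam * V))`. -/
def potential (Q ε lam V : ℝ) : ℝ := Q * (V / (ε * (ε + lam * V)))

lemma potential_nonneg {Q ε lam V : ℝ} (hQ : 0 ≤ Q) (hε : 0 < ε) (hl : 0 ≤ lam) (hV : 0 ≤ V) :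
    0 ≤ potential Q ε lam V := by
  unfold potential
  positivity

lemma potential_sub_ge {Q ε lam V V' δ : ℝ} (hQ : 0 ≤ Q) (hε : 0 < ε) (hl : 0 ≤ lam)
    (hV' : 0 ≤ V') (hVV : V' ≤ V) (h1 : ε ≤ δ) (h2 : lam * V ≤ δ) :
    Q * ((V - V') / (4 * δ ^ 2)) ≤ potential Q ε lam V - potential Q ε lam V' := by
  have hV := hV'.trans hVV
  have a1 : 0 < ε + lam * V := by positivity
  have a2 : 0 < ε + lam * V' := by positivity
  have a3 : ε + lam * V' ≤ ε + lam * V := by gcongr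
  have e : potential Q ε lam V - potential Q ε lam V' =
      Q * ((V - V') / ((ε + lam * V) * (ε + lam * V'))) := by
    unfold potential
    field_simp
    ring
  rw [e]
  have : (ε + lam * V) * (ε + lam * V') ≤ 4 * δ ^ 2 := by nlinarith
  gcongr

lemma potential_le (hn : 2 ≤ n) (hK : Admissible K) {Q ε V : ℝ} (hQ : 0 ≤ Q)
    (hε : 0 < ε) (hV : 0 ≤ V) (hVL : V ≤ Real.log (condNumber K)) :
    potential Q ε (gapSlope K) V ≤ 2 * Q * baseRate K ε := by
  have hL := log_condNumber_ge hn hK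
  have hl := gapSlope_nonneg hn hK
  set L := Real.log (condNumber K) with hLdef
  have hL0 : 0 < L := by linarith
  rw [potential, mul_comm 2 Q, mul_assoc]
  refine mul_le_mul_of_nonneg_left ?_ hQ
  have h1 : V / (ε * (ε + gapSlope K * V)) ≤ L * (1 / ε * (1 / ε)) := by
    rw [div_le_iff₀ (by positivity)]
    have : L * (1 / ε * (1 / ε)) * (ε * (ε + gapSlope K * V)) =
        L + L * gapSlope K * V / ε := by field_simp
    rw [this]
    have : 0 ≤ L * gapSlope K * V / ε := by positivity
    linarith
  by_cases h : diameter K = ⊤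
  · rw [baseRate_eq_of_top h hε]
    have : 0 ≤ L * (1 / ε * (1 / ε)) := by positivity
    linarith
  · rw [baseRate_eq_of_ne_top h hε]
    have hd := one_le_toNat_diameter hn h
    set d : ℝ := ((diameter K).toNat : ℝ) with hddef
    have hs : gapSlope K = 1 / (2 * d * L) := by rw [gapSlope, if_neg h]
    have h2 : V / (ε * (ε + gapSlope K * V)) ≤ 2 * (1 / ε * d * L) := by
      rw [div_le_iff₀ (by positivity)]
      have : 2 * (1 / ε * d * L) * (ε * (ε + gapSlope K * V)) = 2 * d * L * ε + V := by
        rw [hs]; field_simp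
      rw [this]
      have : 0 ≤ 2 * d * L * ε := by positivity
      linarith
    rcases min_cases (1 / ε) d with ⟨hm, -⟩ | ⟨hm, -⟩ <;> rw [hm]
    · have : 0 ≤ L * (1 / ε * (1 / ε)) := by positivity
      linarith
    · exact h2

/-- If a family of updates decreases the sum of the entries on average by `γ` times the sum of the
squared vertex imbalances, then the potential drops on average by `1`. -/
lemma sum_potential_le {α : Type*} [Fintype α] (hn : 2 ≤ n) (hK : Admissible K)
    {xs x : Fin n → ℝ} {ε γ : ℝ} (hε : 0 < ε) (hγ : 0 < γ)
    (hxs : rowSum (scaling K xs) = colSum (scaling K xs))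
    (hx : total (scaling K x) ≤ total K) (hbal : ¬ IsEpsBalanced ε (scaling K x))
    (y : α → Fin n → ℝ) (hy : ∀ a, total (scaling K (y a)) ≤ total (scaling K x))
    (hprog : Fintype.card α * (γ * ∑ k, vertexImbalance (scaling K x) k ^ 2) ≤
      ∑ a, (total (scaling K x) - total (scaling K (y a)))) :
    ∑ a, potential (16 / γ) ε (gapSlope K) (gap K xs (y a)) ≤
      Fintype.card α * (potential (16 / γ) ε (gapSlope K) (gap K xs x) - 1) := by
  have : NeZero n := ⟨by lia⟩
  set δ := imbalance (scaling K x) with hδ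
  set S := total (scaling K x) with hS
  have hS0 : 0 < S := (hK.scaling x).total_pos
  have hεδ : ε ≤ δ := (not_le.1 hbal).le
  have hδ0 : 0 < δ := hε.trans_le hεδ
  have hxsK : total (scaling K xs) ≤ total K := by
    have := gap_nonneg hK hxs 0
    rw [gap, scaling_zero, sub_nonneg] at this
    exact (Real.log_le_log_iff (hK.scaling xs).total_pos hK.total_pos).1 this
  have hl := gapSlope_nonneg hn hK
  have hsl := gapSlope_mul_gap_le hn hK hxsK hx
  have hU : δ ^ 2 * S / 4 ≤ ∑ k, vertexImbalance (scaling K x) k ^ 2 := by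
    have h := sq_sum_abs_le (hK.scaling x)
    have e : ∑ i, |rowSum (scaling K x) i - colSum (scaling K x) i| = δ * S := by
      rw [hδ, imbalance, ← hS, div_mul_cancel₀ _ hS0.ne']
    rw [e] at h
    have : (δ * S) ^ 2 = S * (δ ^ 2 * S) := by ring
    rw [this, mul_comm 4 S, mul_assoc] at h
    have := le_of_mul_le_mul_left h hS0
    linarith
  have hstep : ∀ a, 16 / γ * ((S - total (scaling K (y a))) / S / (4 * δ ^ 2)) ≤
      potential (16 / γ) ε (gapSlope K) (gap K xs x) -
        potential (16 / γ) ε (gapSlope K) (gap K xs (y a)) := by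
    intro a
    have hT0 : 0 < total (scaling K (y a)) := (hK.scaling (y a)).total_pos
    have hlog : (S - total (scaling K (y a))) / S ≤ gap K xs x - gap K xs (y a) := by
      have := Real.log_le_sub_one_of_pos (div_pos hT0 hS0)
      rw [Real.log_div hT0.ne' hS0.ne'] at this
      have e : (S - total (scaling K (y a))) / S = 1 - total (scaling K (y a)) / S := by
        field_simp
      rw [e, gap, gap]
      linarith
    have hle : gap K xs (y a) ≤ gap K xs x :=
      sub_le_sub_right (Real.log_le_log hT0 (hy a)) _
    refine le_trans ?_ (potential_sub_ge (by positivity) hε hl (gap_nonneg hK hxs _) hle hεδ hsl)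
    gcongr
  have hsum := Finset.sum_le_sum fun a (_ : a ∈ Finset.univ) => hstep a
  rw [Finset.sum_sub_distrib, Finset.sum_const, Finset.card_univ, nsmul_eq_mul] at hsum
  have hlow : (Fintype.card α : ℝ) ≤
      ∑ a, 16 / γ * ((S - total (scaling K (y a))) / S / (4 * δ ^ 2)) := by
    rw [← Finset.mul_sum, ← Finset.sum_div, ← Finset.sum_div]
    have h1 : Fintype.card α * (γ * (δ ^ 2 * S / 4)) ≤ ∑ a, (S - total (scaling K (y a))) :=
      le_trans (by gcongr) hprog
    have e : (Fintype.card α : ℝ) =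
        16 / γ * (Fintype.card α * (γ * (δ ^ 2 * S / 4)) / S / (4 * δ ^ 2)) := by
      field_simp
      norm_num
    calc (Fintype.card α : ℝ) = _ := e
      _ ≤ _ := by gcongr
  linarith

end Gap

/-! ### Sequences of block updates -/

section Cycle

variable {n p : ℕ}

/-- The iterates of Block Osborne started at `x`. -/
def runFrom (K : Matrix (Fin n) (Fin n) ℝ) (color : Fin n → Fin p) (ℓ : ℕ → Fin p)
    (x : Fin n → ℝ) : ℕ → Fin n → ℝ
  | 0 => x
  | t + 1 => blockUpdate K color (ℓ t) (runFrom K color ℓ x t)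

lemma iterate_eq_runFrom (K : Matrix (Fin n) (Fin n) ℝ) (color : Fin n → Fin p) (ℓ : ℕ → Fin p)
    (t : ℕ) : iterate K color ℓ t = runFrom K color ℓ 0 t := by
  induction t with
  | zero => rfl
  | succ t ih => rw [iterate, runFrom, ih]

lemma runFrom_congr (K : Matrix (Fin n) (Fin n) ℝ) (color : Fin n → Fin p) {ℓ ℓ' : ℕ → Fin p}
    (x : Fin n → ℝ) {t : ℕ} (h : ∀ s < t, ℓ s = ℓ' s) :
    runFrom K color ℓ x t = runFrom K color ℓ' x t := by
  induction t with
  | zero => rfl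
  | succ t ih =>
    rw [runFrom, runFrom, ih fun s hs => h s (hs.trans t.lt_succ_self), h t t.lt_succ_self]

lemma runFrom_add (K : Matrix (Fin n) (Fin n) ℝ) (color : Fin n → Fin p) (ℓ : ℕ → Fin p)
    (x : Fin n → ℝ) (s t : ℕ) :
    runFrom K color ℓ x (s + t) =
      runFrom K color (fun u => ℓ (s + u)) (runFrom K color ℓ x s) t := by
  induction t with
  | zero => rfl
  | succ t ih => rw [← add_assoc, runFrom, runFrom, ih]

variable {K : Matrix (Fin n) (Fin n) ℝ}

lemma total_runFrom_succ_le (hK : Admissible K) {color : Fin n → Fin p} (hc : IsColoring K color)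
    (ℓ : ℕ → Fin p) (x : Fin n → ℝ) (t : ℕ) :
    blockImbalance (scaling K (runFrom K color ℓ x t)) color (ℓ t) ≤
      total (scaling K (runFrom K color ℓ x t)) -
        total (scaling K (runFrom K color ℓ x (t + 1))) := by
  have := total_blockUpdate_le hK hc (ℓ t) (runFrom K color ℓ x t)
  rw [runFrom]
  linarith

lemma total_runFrom_antitone (hK : Admissible K) {color : Fin n → Fin p} (hc : IsColoring K color)
    (ℓ : ℕ → Fin p) (x : Fin n → ℝ) : Antitone fun t => total (scaling K (runFrom K color ℓ x t)) :=
  antitone_nat_of_succ_le fun t => sub_nonneg.1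
    ((blockImbalance_nonneg _ _ _).trans (total_runFrom_succ_le hK hc ℓ x t))

/-! ### Averages over random orders -/

/-- If `G σ` depends only on the first `m` values of `σ`, then, for `m ≤ s`, `σ s` is uniformly
distributed among the remaining values, by symmetry under transpositions of late positions. The
dependence enters only through this symmetry. -/
lemma sum_perm_apply (m s : Fin p) (G : Equiv.Perm (Fin p) → Fin p → ℝ)
    (hG : ∀ σ j, m ≤ j → G (σ * Equiv.swap s j) = G σ) :
    ((p : ℝ) - m) * ∑ σ, G σ (σ s) = ∑ σ : Equiv.Perm (Fin p), ∑ j ∈ Finset.Ici m, G σ (σ j) := by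
  have h : ∀ j ∈ Finset.Ici m, ∑ σ : Equiv.Perm (Fin p), G σ (σ j) = ∑ σ, G σ (σ s) := by
    intro j hj
    rw [← Equiv.sum_comp (Equiv.mulRight (Equiv.swap s j)) fun σ => G σ (σ s)]
    refine Finset.sum_congr rfl fun σ _ => ?_
    simp [hG σ j (Finset.mem_Ici.1 hj)]
  rw [Finset.sum_comm, Finset.sum_congr rfl h, Finset.sum_const, Fin.card_Ici, nsmul_eq_mul,
    Nat.cast_sub m.2.le]

lemma sum_perm_apply_le (m s : Fin p) (G : Equiv.Perm (Fin p) → Fin p → ℝ)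
    (hG0 : ∀ σ b, 0 ≤ G σ b) (hG : ∀ σ j, m ≤ j → G (σ * Equiv.swap s j) = G σ) :
    ((p : ℝ) - m) * ∑ σ, G σ (σ s) ≤ ∑ σ : Equiv.Perm (Fin p), ∑ b, G σ b := by
  rw [sum_perm_apply m s G hG]
  refine Finset.sum_le_sum fun σ _ => ?_
  rw [← Equiv.sum_comp σ]
  exact Finset.sum_le_sum_of_subset_of_nonneg (Finset.subset_univ _) fun j _ _ => hG0 σ _

lemma sum_perm_apply_const (s : Fin p) (F : Fin p → ℝ) :
    (p : ℝ) * ∑ σ : Equiv.Perm (Fin p), F (σ s) =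
      Fintype.card (Equiv.Perm (Fin p)) * ∑ b, F b := by
  have : NeZero p := ⟨(Nat.zero_le _).trans_lt s.2 |>.ne'⟩
  have h := sum_perm_apply 0 s (fun _ => F) fun _ _ _ => rfl
  have h0 : Finset.Ici (0 : Fin p) = Finset.univ := by ext; simp
  simp only [Fin.val_zero, Nat.cast_zero, sub_zero, h0] at h
  rw [h, Finset.sum_congr rfl fun σ _ => Equiv.sum_comp σ F, Finset.sum_const, Finset.card_univ,
    nsmul_eq_mul]

/-- The periodic sequence of blocks that repeats the order `σ`. -/
def cycleSeq (hp : 0 < p) (σ : Equiv.Perm (Fin p)) (t : ℕ) : Fin p := σ ⟨t % p, Nat.mod_lt t hp⟩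

/-- The effect of a cycle of updates in the order `σ`. -/
def cycleUpdate (K : Matrix (Fin n) (Fin n) ℝ) (color : Fin n → Fin p) (hp : 0 < p)
    (σ : Equiv.Perm (Fin p)) (x : Fin n → ℝ) : Fin n → ℝ :=
  runFrom K color (cycleSeq hp σ) x p

lemma cycleSeq_of_lt (hp : 0 < p) (σ : Equiv.Perm (Fin p)) {t : ℕ} (ht : t < p) :
    cycleSeq hp σ t = σ ⟨t, ht⟩ := by
  simp only [cycleSeq, Nat.mod_eq_of_lt ht]

lemma runFrom_cycleSeq_mul_swap (color : Fin n → Fin p) (hp : 0 < p) (x : Fin n → ℝ)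
    (σ : Equiv.Perm (Fin p)) {m s j : Fin p} (hs : m ≤ s) (hj : m ≤ j) {t : ℕ} (ht : t ≤ m) :
    runFrom K color (cycleSeq hp (σ * Equiv.swap s j)) x t =
      runFrom K color (cycleSeq hp σ) x t := by
  refine runFrom_congr K color x fun u hu => ?_
  have hum : u < m := hu.trans_le ht
  have hup : u < p := hum.trans m.2
  rw [cycleSeq_of_lt hp _ hup, cycleSeq_of_lt hp _ hup, Equiv.Perm.mul_apply,
    Equiv.swap_apply_of_ne_of_ne]
  · rintro rfl
    exact absurd hs (not_le.2 hum)
  · rintro rfl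
    exact absurd hj (not_le.2 hum)

/-- An early imbalance is still present later on, unless it was changed in between. -/
lemma sq_le_two_mul_add (f : ℕ → ℝ) (s : ℕ) :
    f 0 ^ 2 ≤ 2 * f s ^ 2 + 2 * s * ∑ i ∈ Finset.range s, (f (i + 1) - f i) ^ 2 := by
  have h1 : f s - f 0 = ∑ i ∈ Finset.range s, (f (i + 1) - f i) := (Finset.sum_range_sub f s).symm
  have h2 := sq_sum_le_card_mul_sum_sq (s := Finset.range s) (f := fun i => f (i + 1) - f i)
  rw [← h1, Finset.card_range] at h2
  nlinarith [sq_nonneg (f s + (f s - f 0)), sq_nonneg (f 0 - 2 * f s)]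

/-- The expected progress in a cycle with a uniformly random order. Among the first `√p` blocks of
the cycle, the updates of earlier blocks rarely disturb the imbalances of the later ones, because the
later blocks form a random set of at most `√p` blocks. Hence the progress of the cycle is of the
order of the initial imbalance of `√p` random blocks. -/
lemma cycle_progress (hK : Admissible K) {color : Fin n → Fin p} (hc : IsColoring K color)
    (hp : 0 < p) (x : Fin n → ℝ) :
    (Fintype.card (Equiv.Perm (Fin p)) : ℝ) *
        (1 / (68 * Real.sqrt p) * ∑ k, vertexImbalance (scaling K x) k ^ 2) ≤
      ∑ σ, (total (scaling K x) - total (scaling K (cycleUpdate K color hp σ x))) := by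
  set U := ∑ k, vertexImbalance (scaling K x) k ^ 2 with hU
  have hU0 : 0 ≤ U := Finset.sum_nonneg fun _ _ => sq_nonneg _
  set N : ℝ := ((Fintype.card (Equiv.Perm (Fin p)) : ℕ) : ℝ) with hN
  set X : Equiv.Perm (Fin p) → ℕ → Fin n → ℝ := fun σ => runFrom K color (cycleSeq hp σ) x with hX
  set T : Equiv.Perm (Fin p) → ℕ → ℝ := fun σ t =>
    total (scaling K (X σ t)) - total (scaling K (X σ (t + 1))) with hT
  set D : Equiv.Perm (Fin p) → ℕ → Fin p → ℝ := fun σ i b => ∑ k, if color k = b then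
    (vertexImbalance (scaling K (X σ (i + 1))) k - vertexImbalance (scaling K (X σ i)) k) ^ 2
    else 0 with hD
  have hTb : ∀ σ t, blockImbalance (scaling K (X σ t)) color (cycleSeq hp σ t) ≤ T σ t :=
    fun σ t => total_runFrom_succ_le hK hc _ x t
  have hT0 : ∀ σ t, 0 ≤ T σ t := fun σ t => (blockImbalance_nonneg _ _ _).trans (hTb σ t)
  have hD0 : ∀ σ i b, 0 ≤ D σ i b := fun σ i b =>
    Finset.sum_nonneg fun k _ => by split_ifs <;> positivity
  have hDsum : ∀ σ i, ∑ b, D σ i b ≤ 8 * T σ i := by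
    intro σ i
    rw [sum_ite_color]
    exact (sum_sq_vertexImbalance_sub_le hK hc (cycleSeq hp σ i) (X σ i)).trans
      (mul_le_mul_of_nonneg_left (hTb σ i) (by norm_num))
  -- the initial imbalance of the block at position `s` is resolved at time `s`, or it was disturbed
  -- by an earlier update
  have hF1 : ∀ σ s, blockImbalance (scaling K x) color (cycleSeq hp σ s) ≤
      2 * T σ s + 2 * s * ∑ i ∈ Finset.range s, D σ i (cycleSeq hp σ s) := by
    intro σ s
    refine le_trans ?_ (add_le_add_left (mul_le_mul_of_nonneg_left (hTb σ s) two_pos.le) _)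
    rw [Finset.sum_comm, blockImbalance_eq, blockImbalance_eq, Finset.mul_sum, Finset.mul_sum,
      ← Finset.sum_add_distrib]
    refine Finset.sum_le_sum fun k _ => ?_
    split_ifs with hk
    · exact sq_le_two_mul_add (fun t => vertexImbalance (scaling K (X σ t)) k) s
    · simp
  have hp0 : (0 : ℝ) < p := by exact_mod_cast hp
  set q := Nat.sqrt p with hq
  have hqq : q * q ≤ p := Nat.sqrt_le p
  have hq1 : 1 ≤ q := Nat.sqrt_pos.2 hp
  have hqp : q ≤ p := Nat.sqrt_le_self p
  set P : ℝ := ∑ σ, ∑ i ∈ Finset.range q, T σ i with hP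
  -- the disturbance by update `i` is independent of which remaining block is at position `s > i`
  have hF3 : ∀ s < q, ∀ i < s, (p : ℝ) * ∑ σ, D σ i (cycleSeq hp σ s) ≤ 16 * ∑ σ, T σ i := by
    intro s hs i hi
    have hsp : s < p := hs.trans_le hqp
    have hip : i + 1 < p := by lia
    have h1 := sum_perm_apply_le ⟨i + 1, hip⟩ ⟨s, hsp⟩ (fun σ => D σ i)
      (fun σ b => hD0 σ i b) (fun σ j hj => by
        simp only [hD, hX]
        rw [runFrom_cycleSeq_mul_swap color hp x σ (m := ⟨i + 1, hip⟩) (Fin.mk_le_mk.2 hi) hj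
            le_rfl,
          runFrom_cycleSeq_mul_swap color hp x σ (m := ⟨i + 1, hip⟩) (Fin.mk_le_mk.2 hi) hj
            (Nat.le_succ i)])
    have h2 : ∑ σ, ∑ b, D σ i b ≤ 8 * ∑ σ, T σ i := by
      rw [Finset.mul_sum]
      exact Finset.sum_le_sum fun σ _ => hDsum σ i
    have h3 : (p : ℝ) ≤ 2 * (p - ((i + 1 : ℕ) : ℝ)) := by
      have : 2 * (i + 1) ≤ p := by nlinarith
      have : (2 : ℝ) * ((i + 1 : ℕ) : ℝ) ≤ p := by exact_mod_cast this
      linarith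
    simp only [cycleSeq_of_lt hp _ hsp]
    have h4 : 0 ≤ ∑ σ : Equiv.Perm (Fin p), D σ i (σ ⟨s, hsp⟩) :=
      Finset.sum_nonneg fun σ _ => hD0 σ i _
    have h5 := mul_le_mul_of_nonneg_right h3 h4
    simp only at h1
    linarith
  have hP0 : 0 ≤ P := Finset.sum_nonneg fun σ _ => Finset.sum_nonneg fun i _ => hT0 σ i
  have hrow : ∀ s < q, N * U ≤ 2 * p * ∑ σ, T σ s + 32 * q * P := by
    intro s hs
    have hsp : s < p := hs.trans_le hqp
    rw [hN, hU, ← sum_blockImbalance _ color, ← sum_perm_apply_const ⟨s, hsp⟩]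
    have h1 : ∑ σ : Equiv.Perm (Fin p), blockImbalance (scaling K x) color (σ ⟨s, hsp⟩) ≤
        2 * ∑ σ, T σ s + 2 * s * ∑ i ∈ Finset.range s, ∑ σ, D σ i (cycleSeq hp σ s) := by
      rw [Finset.sum_comm (s := Finset.range s), Finset.mul_sum, Finset.mul_sum,
        ← Finset.sum_add_distrib]
      refine Finset.sum_le_sum fun σ _ => ?_
      rw [← cycleSeq_of_lt hp]
      exact hF1 σ s
    have h2 : (p : ℝ) * ∑ i ∈ Finset.range s, ∑ σ, D σ i (cycleSeq hp σ s) ≤ 16 * P := by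
      rw [Finset.mul_sum, hP, Finset.sum_comm, Finset.mul_sum]
      refine (Finset.sum_le_sum fun i hi => hF3 s hs i (Finset.mem_range.1 hi)).trans ?_
      exact Finset.sum_le_sum_of_subset_of_nonneg (Finset.range_mono hs.le)
        fun i _ _ => mul_nonneg (by norm_num) (Finset.sum_nonneg fun σ _ => hT0 σ i)
    have h3 : (s : ℝ) ≤ q := by exact_mod_cast hs.le
    have h4 := mul_le_mul_of_nonneg_left h1 hp0.le
    have h5 := mul_le_mul_of_nonneg_left h2 (by positivity : (0 : ℝ) ≤ 2 * s)
    have h6 := mul_le_mul_of_nonneg_right h3 hP0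
    linarith
  have hall : q * (N * U) ≤ 34 * p * P := by
    have h1 := Finset.sum_le_sum fun s (hs : s ∈ Finset.range q) => hrow s (Finset.mem_range.1 hs)
    rw [Finset.sum_const, Finset.card_range, nsmul_eq_mul, Finset.sum_add_distrib,
      ← Finset.mul_sum, Finset.sum_comm, Finset.sum_const, Finset.card_range, nsmul_eq_mul,
      ← hP] at h1
    have h2 : (q : ℝ) * q ≤ p := by exact_mod_cast hqq
    have h3 := mul_le_mul_of_nonneg_right h2 hP0
    linarith
  have hPY : P ≤ ∑ σ, (total (scaling K x) - total (scaling K (cycleUpdate K color hp σ x))) := by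
    refine Finset.sum_le_sum fun σ _ => ?_
    rw [Finset.sum_range_sub' fun t => total (scaling K (X σ t))]
    exact sub_le_sub_left (total_runFrom_antitone hK hc (cycleSeq hp σ) x hqp) _
  refine le_trans ?_ hPY
  have hsq : Real.sqrt p ≤ 2 * q := by
    have h1 := Nat.lt_succ_sqrt p
    rw [← hq] at h1
    rw [Real.sqrt_le_left (by positivity)]
    have : p ≤ (2 * q) ^ 2 := by
      rw [Nat.succ_eq_add_one] at h1
      nlinarith
    exact_mod_cast this
  have hs0 : 0 < Real.sqrt p := Real.sqrt_pos.2 hp0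
  have hss : Real.sqrt p * Real.sqrt p = p := Real.mul_self_sqrt hp0.le
  have hNU : 0 ≤ N * U := mul_nonneg (Nat.cast_nonneg _) hU0
  have h1 : Real.sqrt p * (N * U) ≤ Real.sqrt p * (68 * Real.sqrt p * P) := by
    have := mul_le_mul_of_nonneg_right hsq hNU
    calc Real.sqrt p * (N * U) ≤ 2 * (q * (N * U)) := by linarith
      _ ≤ 68 * p * P := by linarith
      _ = 68 * (Real.sqrt p * Real.sqrt p) * P := by rw [hss]
      _ = _ := by ring
  have h2 := le_of_mul_le_mul_left h1 hs0
  have e : N * (1 / (68 * Real.sqrt p) * U) = N * U / (68 * Real.sqrt p) := by ring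
  rw [e, div_le_iff₀ (by positivity)]
  linarith

end Cycle

/-! ### Correctness of the implementation -/

section Implementation

variable {n p : ℕ}

/-- The sums stored in `s` are those of the matrix `A`. -/
structure Represents (A : Matrix (Fin n) (Fin n) ℝ) (s : State n) : Prop where
  row : s.row = rowSum A
  col : s.col = colSum A
  tot : s.tot = total A
  imb : s.imb = ∑ i, |rowSum A i - colSum A i|

lemma rowSum_add_single (A : Matrix (Fin n) (Fin n) ℝ) (i j : Fin n) (δ : ℝ) :
    rowSum (A + Matrix.single i j δ) = Function.update (rowSum A) i (rowSum A i + δ) := by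
  ext k
  by_cases hk : k = i
  · subst hk
    simp [rowSum, Matrix.single_apply, Finset.sum_add_distrib]
  · simp [rowSum, hk, Ne.symm hk]

lemma colSum_add_single (A : Matrix (Fin n) (Fin n) ℝ) (i j : Fin n) (δ : ℝ) :
    colSum (A + Matrix.single i j δ) = Function.update (colSum A) j (colSum A j + δ) := by
  ext k
  by_cases hk : k = j
  · subst hk
    simp [colSum, Matrix.single_apply, Finset.sum_add_distrib]
  · simp [colSum, hk, Ne.symm hk]

lemma total_add_single (A : Matrix (Fin n) (Fin n) ℝ) (i j : Fin n) (δ : ℝ) :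
    total (A + Matrix.single i j δ) = total A + δ := by
  rw [total_eq_sum_rowSum, total_eq_sum_rowSum, rowSum_add_single,
    Finset.sum_update_of_mem (Finset.mem_univ i), Finset.sdiff_singleton_eq_erase,
    ← Finset.add_sum_erase _ _ (Finset.mem_univ i)]
  ring

lemma sum_abs_sub_of_eq_off {f g : Fin n → ℝ} (i : Fin n) (h : ∀ k, k ≠ i → f k = g k) :
    ∑ k, |f k| = ∑ k, |g k| - |g i| + |f i| := by
  rw [← Finset.add_sum_erase _ _ (Finset.mem_univ i),
    ← Finset.add_sum_erase (a := i) _ (fun k => |g k|) (Finset.mem_univ i),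
    Finset.sum_congr rfl fun k hk => by rw [h k (Finset.ne_of_mem_erase hk)]]
  ring

lemma addEntry_ops (i j : Fin n) (δ : ℝ) (s : State n) : (addEntry i j δ s).ops = 15 := rfl

lemma addEntry_x (i j : Fin n) (δ : ℝ) (s : State n) : (addEntry i j δ s).val.x = s.x := rfl

lemma addEntry_represents {A : Matrix (Fin n) (Fin n) ℝ} {s : State n} (h : Represents A s)
    (i j : Fin n) (δ : ℝ) : Represents (A + Matrix.single i j δ) (addEntry i j δ s).val := by
  refine ⟨?_, ?_, ?_, ?_⟩
  · rw [rowSum_add_single, ← h.row]; rfl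
  · rw [colSum_add_single, ← h.col]; rfl
  · rw [total_add_single, ← h.tot]; rfl
  · rw [rowSum_add_single, colSum_add_single, ← h.row, ← h.col]
    have h1 := sum_abs_sub_of_eq_off
      (f := fun k => Function.update s.row i (s.row i + δ) k - s.col k)
      (g := fun k => s.row k - s.col k) i fun k hk => by simp [hk]
    have h2 := sum_abs_sub_of_eq_off
      (f := fun k => Function.update s.row i (s.row i + δ) k -
        Function.update s.col j (s.col j + δ) k)
      (g := fun k => Function.update s.row i (s.row i + δ) k - s.col k) j
      fun k hk => by simp [hk]
    have himb := h.imb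
    rw [← h.row, ← h.col] at himb
    rw [h2, h1, ← himb]
    simp only [Function.update_self]
    rfl

lemma foldlM_ops {α β : Type} (f : β → α → Timed β) (w : α → ℕ) (hf : ∀ s a, (f s a).ops = w a)
    (l : List α) (s : β) : (l.foldlM f s).ops = (l.map w).sum := by
  induction l generalizing s with
  | nil => rfl
  | cons a l ih =>
    rw [List.map_cons, List.sum_cons, ← hf s a, ← ih (f s a).val]
    rfl

lemma represents_foldlM {γ : Type} (i j : γ → Fin n) (d : (Fin n → ℝ) → γ → ℝ)
    (f : State n → γ → Timed (State n))
    (hf : ∀ s c, (f s c).val = (addEntry (i c) (j c) (d s.x c) s).val) (l : List γ) (s : State n)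
    (A : Matrix (Fin n) (Fin n) ℝ) (h : Represents A s) :
    Represents (A + (l.map fun c => Matrix.single (i c) (j c) (d s.x c)).sum) (l.foldlM f s).val ∧
      (l.foldlM f s).val.x = s.x := by
  induction l generalizing s A with
  | nil => simpa using ⟨h, rfl⟩
  | cons c l ih =>
    have hx : (f s c).val.x = s.x := by rw [hf, addEntry_x]
    have hr : Represents (A + Matrix.single (i c) (j c) (d s.x c)) (f s c).val := by
      rw [hf]
      exact addEntry_represents h _ _ _
    have := ih (f s c).val _ hr
    rw [hx] at this
    rw [List.map_cons, List.sum_cons, ← add_assoc]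
    exact this

lemma initState_ops (K : Matrix (Fin n) (Fin n) ℝ) : (initState K).ops = 15 * numNonzero K := by
  rw [initState, foldlM_ops _ (fun _ => 15) (fun s e => addEntry_ops _ _ _ _)]
  simp [numNonzero, mul_comm]

lemma initState_spec (K : Matrix (Fin n) (Fin n) ℝ) :
    Represents K (initState K).val ∧ (initState K).val.x = 0 := by
  have h0 : Represents (0 : Matrix (Fin n) (Fin n) ℝ) ⟨0, 0, 0, 0, 0⟩ := by
    refine ⟨?_, ?_, ?_, ?_⟩
    · ext; simp [rowSum]
    · ext; simp [colSum]
    · simp [total]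
    · simp [rowSum, colSum]
  have h := represents_foldlM (fun e : Fin n × Fin n => e.1) (fun e => e.2)
    (fun _ e => K e.1 e.2) (fun s e => addEntry e.1 e.2 (K e.1 e.2) s) (fun _ _ => rfl)
    (Finset.univ.filter fun e : Fin n × Fin n => K e.1 e.2 ≠ 0).toList _ _ h0
  have e : (0 : Matrix (Fin n) (Fin n) ℝ) +
      ((Finset.univ.filter fun e : Fin n × Fin n => K e.1 e.2 ≠ 0).toList.map
        fun e => Matrix.single e.1 e.2 (K e.1 e.2)).sum = K := by
    rw [zero_add, Finset.sum_map_toList]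
    ext a b
    rw [Matrix.sum_apply]
    by_cases hab : K a b = 0
    · rw [hab]
      refine Finset.sum_eq_zero fun e he => ?_
      rw [Matrix.single_apply, if_neg]
      rintro ⟨rfl, rfl⟩
      exact (Finset.mem_filter.1 he).2 hab
    · rw [Finset.sum_eq_single (a, b)]
      · simp
      · rintro ⟨c, d⟩ _ hne
        rw [Matrix.single_apply, if_neg]
        rintro ⟨rfl, rfl⟩
        exact hne rfl
      · intro h
        simp [hab] at h
  rw [e] at h
  exact h

/-- The number of operations of `updateVertex`. -/
def vertexCost (K : Matrix (Fin n) (Fin n) ℝ) (k : Fin n) : ℕ :=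
  5 + 22 * ((outNbrs K k).length + (inNbrs K k).length)

lemma updateVertex_ops (K : Matrix (Fin n) (Fin n) ℝ) (s : State n) (k : Fin n) :
    (updateVertex K s k).ops = vertexCost K k := by
  have h : ∀ (f : State n → Fin n → Timed (State n)) (_ : ∀ s a, (f s a).ops = 22)
      (l : List (Fin n)) (s : State n), (l.foldlM f s).ops = 22 * l.length := by
    intro f hf l s
    rw [foldlM_ops f (fun _ => 22) hf]
    simp [mul_comm]
  simp only [updateVertex, bind, pure, op, vertexCost]
  rw [h, h]
  · ring
  · intros; rfl
  · intros; rfl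

lemma sum_single_row (k : Fin n) (F : Finset (Fin n)) (g : Fin n → ℝ) (a b : Fin n) :
    (∑ j ∈ F, Matrix.single k j (g j)) a b = if a = k ∧ b ∈ F then g b else 0 := by
  rw [Matrix.sum_apply]
  simp only [Matrix.single_apply]
  by_cases ha : a = k
  · subst ha
    simp
  · simp [ha, Ne.symm ha]

lemma sum_single_col (k : Fin n) (F : Finset (Fin n)) (g : Fin n → ℝ) (a b : Fin n) :
    (∑ j ∈ F, Matrix.single j k (g j)) a b = if b = k ∧ a ∈ F then g a else 0 := by
  rw [Matrix.sum_apply]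
  simp only [Matrix.single_apply]
  by_cases hb : b = k
  · subst hb
    simp
  · simp [hb, Ne.symm hb]

/-- The effect of changing one coordinate on the entries of a scaling. -/
lemma scaling_update (K : Matrix (Fin n) (Fin n) ℝ) (x : Fin n → ℝ) (k : Fin n) (y : ℝ) :
    scaling K (Function.update x k y) = scaling K x +
      ((outNbrs K k).map fun j => Matrix.single k j
        (Real.exp (y - x j) * K k j - Real.exp (x k - x j) * K k j)).sum +
      ((inNbrs K k).map fun j => Matrix.single j k
        (Real.exp (x j - y) * K j k - Real.exp (x j - x k) * K j k)).sum := by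
  rw [outNbrs, inNbrs, Finset.sum_map_toList, Finset.sum_map_toList]
  ext a b
  rw [Matrix.add_apply, Matrix.add_apply, sum_single_row, sum_single_col, scaling_apply,
    scaling_apply]
  simp only [Finset.mem_filter, Finset.mem_univ, true_and]
  by_cases ha : a = k
  · subst ha
    by_cases hb : b = a
    · subst hb
      simp
    · by_cases hab : K a b = 0
      · simp [hb, hab]
      · simp [hb, hab]
        ring
  · by_cases hb : b = k
    · subst hb
      by_cases hab : K a b = 0
      · simp [ha, hab]
      · simp [ha, hab]
        ring
    · simp [ha, hb]

lemma updateVertex_spec {K : Matrix (Fin n) (Fin n) ℝ} {s : State n}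
    (h : Represents (scaling K s.x) s) (k : Fin n) :
    (updateVertex K s k).val.x = Function.update s.x k (s.x k +
        (Real.log (colSum (scaling K s.x) k) - Real.log (rowSum (scaling K s.x) k)) / 2) ∧
      Represents (scaling K (updateVertex K s k).val.x) (updateVertex K s k).val := by
  rw [← h.row, ← h.col]
  set y := s.x k + (Real.log (s.col k) - Real.log (s.row k)) / 2 with hy
  set s1 := ((outNbrs K k).foldlM (fun (s : State n) j => do
    let old ← scaledEntry (s.x k) (s.x j) (K k j)
    let new ← scaledEntry y (s.x j) (K k j)
    let δ ← op (new - old)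
    addEntry k j δ s) s).val with hs1
  set s2 := ((inNbrs K k).foldlM (fun (s : State n) j => do
    let old ← scaledEntry (s.x j) (s.x k) (K j k)
    let new ← scaledEntry (s.x j) y (K j k)
    let δ ← op (new - old)
    addEntry j k δ s) s1).val with hs2
  have hval : (updateVertex K s k).val = { s2 with x := Function.update s2.x k y } := rfl
  obtain ⟨r1, x1⟩ := represents_foldlM (fun _ : Fin n => k) (fun j => j)
    (fun x j => Real.exp (y - x j) * K k j - Real.exp (x k - x j) * K k j)
    (fun (s : State n) j => do
      let old ← scaledEntry (s.x k) (s.x j) (K k j)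
      let new ← scaledEntry y (s.x j) (K k j)
      let δ ← op (new - old)
      addEntry k j δ s) (fun _ _ => rfl) (outNbrs K k) s _ h
  rw [← hs1] at r1 x1
  obtain ⟨r2, x2⟩ := represents_foldlM (fun j : Fin n => j) (fun _ => k)
    (fun x j => Real.exp (x j - y) * K j k - Real.exp (x j - x k) * K j k)
    (fun (s : State n) j => do
      let old ← scaledEntry (s.x j) (s.x k) (K j k)
      let new ← scaledEntry (s.x j) y (K j k)
      let δ ← op (new - old)
      addEntry j k δ s) (fun _ _ => rfl) (inNbrs K k) s1 _ r1
  rw [← hs2] at r2 x2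
  rw [x1, ← scaling_update] at r2
  rw [hval, x2, x1]
  exact ⟨rfl, r2.row, r2.col, r2.tot, r2.imb⟩

/-- Changing coordinates of other vertices of the same block does not affect the row and column sums
of a vertex. -/
lemma rowSum_colSum_congr {K : Matrix (Fin n) (Fin n) ℝ} {color : Fin n → Fin p}
    (hc : IsColoring K color) {x y : Fin n → ℝ} {k : Fin n} (hk : x k = y k)
    (h : ∀ j, color j ≠ color k → x j = y j) :
    rowSum (scaling K x) k = rowSum (scaling K y) k ∧
      colSum (scaling K x) k = colSum (scaling K y) k := by
  have hj : ∀ j, x j = y j ∨ (K k j = 0 ∧ K j k = 0) := by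
    intro j
    by_cases hjk : j = k
    · exact Or.inl (hjk ▸ hk)
    by_cases hcol : color j = color k
    · exact Or.inr ⟨hc.2 k j (Ne.symm hjk) hcol.symm, hc.2 j k hjk hcol⟩
    · exact Or.inl (h j hcol)
  constructor <;> refine Finset.sum_congr rfl fun j _ => ?_ <;>
    rw [scaling_apply, scaling_apply] <;> rcases hj j with h | ⟨h1, h2⟩
  · rw [h, hk]
  · rw [h1, zero_mul, zero_mul]
  · rw [h, hk]
  · rw [h2, zero_mul, zero_mul]

/-- Updating the vertices of a block one after the other has the effect of a simultaneous update. -/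
lemma foldlM_updateVertex_spec {K : Matrix (Fin n) (Fin n) ℝ} {color : Fin n → Fin p}
    (hc : IsColoring K color) (b : Fin p) (x : Fin n → ℝ) (l : List (Fin n)) (hl : l.Nodup)
    (hlb : ∀ k ∈ l, color k = b) (s : State n) (hs : Represents (scaling K s.x) s)
    (hsl : ∀ k ∈ l, s.x k = x k) (hsb : ∀ k, color k ≠ b → s.x k = x k) :
    (l.foldlM (updateVertex K) s).val.x =
        (fun k => if k ∈ l then blockUpdate K color b x k else s.x k) ∧
      Represents (scaling K (l.foldlM (updateVertex K) s).val.x)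
        (l.foldlM (updateVertex K) s).val := by
  induction l generalizing s with
  | nil => exact ⟨by simp; rfl, hs⟩
  | cons k l ih =>
    rw [List.nodup_cons] at hl
    have hkb : color k = b := hlb k List.mem_cons_self
    obtain ⟨hx, hr⟩ := updateVertex_spec hs k
    have hkx : s.x k = x k := hsl k List.mem_cons_self
    have hcongr := rowSum_colSum_congr hc hkx fun j hj => hsb j (hkb ▸ hj)
    have hupd : (updateVertex K s k).val.x = Function.update s.x k (blockUpdate K color b x k) := by
      rw [hx, hcongr.1, hcongr.2, hkx, blockUpdate, if_pos hkb]
    obtain ⟨h1, h2⟩ := ih hl.2 (fun j hj => hlb j (List.mem_cons_of_mem _ hj))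
      (updateVertex K s k).val hr
      (fun j hj => by
        rw [hupd, Function.update_of_ne (by rintro rfl; exact hl.1 hj)]
        exact hsl j (List.mem_cons_of_mem _ hj))
      (fun j hj => by
        rw [hupd, Function.update_of_ne (by rintro rfl; exact hj hkb)]
        exact hsb j hj)
    refine ⟨?_, h2⟩
    refine Eq.trans h1 ?_
    ext j
    by_cases hjk : j = k
    · subst hjk
      simp [hl.1, hupd]
    · simp [hjk, hupd]

lemma updateBlock_spec {K : Matrix (Fin n) (Fin n) ℝ} {color : Fin n → Fin p}
    (hc : IsColoring K color) (b : Fin p) (s : State n) (hs : Represents (scaling K s.x) s) :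
    (updateBlock K color b s).val.x = blockUpdate K color b s.x ∧
      Represents (scaling K (updateBlock K color b s).val.x) (updateBlock K color b s).val := by
  have h := foldlM_updateVertex_spec hc b s.x (blockList color b) (Finset.nodup_toList _)
    (fun k hk => by simpa [blockList] using hk) s hs (fun _ _ => rfl) (fun _ _ => rfl)
  refine ⟨h.1.trans ?_, h.2⟩
  ext k
  by_cases hk : color k = b <;> simp [blockList, hk, blockUpdate]

/-- The number of operations of `updateBlock`. -/
def blockCost (K : Matrix (Fin n) (Fin n) ℝ) (color : Fin n → Fin p) (b : Fin p) : ℕ :=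
  ∑ k with color k = b, vertexCost K k

lemma updateBlock_ops (K : Matrix (Fin n) (Fin n) ℝ) (color : Fin n → Fin p) (b : Fin p)
    (s : State n) : (updateBlock K color b s).ops = blockCost K color b := by
  rw [updateBlock, foldlM_ops _ _ (updateVertex_ops K), blockList, Finset.sum_map_toList, blockCost]

lemma exec_spec {K : Matrix (Fin n) (Fin n) ℝ} {ε : ℝ} {color : Fin n → Fin p}
    (hc : IsColoring K color) {choose : ℕ → State n → Timed (Fin p)} {ℓ : ℕ → Fin p}
    (h : ∀ t, (choose t (exec K ε color choose t).val).val = ℓ t) (t : ℕ) :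
    (exec K ε color choose t).val.x = iterate K color ℓ t ∧
      Represents (scaling K (iterate K color ℓ t)) (exec K ε color choose t).val := by
  induction t with
  | zero =>
    rw [iterate, scaling_zero]
    exact ⟨(initState_spec K).2, (initState_spec K).1⟩
  | succ t ih =>
    have e : (exec K ε color choose (t + 1)).val =
        (updateBlock K color (choose t (exec K ε color choose t).val).val
          (exec K ε color choose t).val).val := rfl
    rw [e, h]
    have := updateBlock_spec hc (ℓ t) (exec K ε color choose t).val (by rw [ih.1]; exact ih.2)
    rw [this.1, ih.1] at this
    rw [iterate]
    exact ⟨by rw [(updateBlock_spec hc (ℓ t) (exec K ε color choose t).val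
      (by rw [ih.1]; exact ih.2)).1, ih.1], this.2⟩

lemma implements_of_choose [NeZero n] {K : Matrix (Fin n) (Fin n) ℝ} (hK : Admissible K) {ε : ℝ}
    {color : Fin n → Fin p} (hc : IsColoring K color) {choose : ℕ → State n → Timed (Fin p)}
    {ℓ : ℕ → Fin p} (h : ∀ t, (choose t (exec K ε color choose t).val).val = ℓ t) :
    Implements K ε color choose ℓ := by
  intro t
  obtain ⟨hx, hr⟩ := exec_spec hc h t
  refine ⟨hx, ?_⟩
  have e : Stops K ε color choose t ↔
      (exec K ε color choose t).val.imb ≤ ε * (exec K ε color choose t).val.tot := Iff.rfl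
  rw [e, hr.imb, hr.tot, IsEpsBalanced, div_le_iff₀ (hK.scaling _).total_pos]

/-! ### Operation counts -/

lemma exec_ops {K : Matrix (Fin n) (Fin n) ℝ} {ε : ℝ} {color : Fin n → Fin p}
    {choose : ℕ → State n → Timed (Fin p)} {ℓ : ℕ → Fin p} {c : ℕ}
    (h : ∀ t, (choose t (exec K ε color choose t).val).val = ℓ t)
    (hops : ∀ t s, (choose t s).ops = c) (t : ℕ) :
    (exec K ε color choose t).ops =
      15 * numNonzero K + ∑ s ∈ Finset.range t, (2 + c + blockCost K color (ℓ s)) := by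
  induction t with
  | zero => exact initState_ops K
  | succ t ih =>
    rw [Finset.sum_range_succ, ← add_assoc, ← ih]
    have e : (exec K ε color choose (t + 1)).ops = (exec K ε color choose t).ops +
        (2 + ((choose t (exec K ε color choose t).val).ops +
          (updateBlock K color (choose t (exec K ε color choose t).val).val
            (exec K ε color choose t).val).ops)) := rfl
    rw [e, h, hops, updateBlock_ops]
    ring

lemma work_le {K : Matrix (Fin n) (Fin n) ℝ} {ε : ℝ} {color : Fin n → Fin p}
    {choose : ℕ → State n → Timed (Fin p)} {ℓ : ℕ → Fin p} {c : ℕ}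
    (himp : Implements K ε color choose ℓ)
    (h : ∀ t, (choose t (exec K ε color choose t).val).val = ℓ t)
    (hops : ∀ t s, (choose t s).ops = c) {t : ℕ}
    (ht : IsEpsBalanced ε (scaling K (iterate K color ℓ t))) :
    work K ε color choose ≤
      ((15 * numNonzero K + 2 + ∑ s ∈ Finset.range t, (2 + c + blockCost K color (ℓ s)) : ℕ) :
        ℕ∞) := by
  classical
  have h_halt : Stops K ε color choose t := (himp t).2.2 ht
  have hex : ∃ t, Stops K ε color choose t := ⟨t, h_halt⟩
  rw [work, dif_pos hex]
  have hle : Nat.find hex ≤ t := Nat.find_min' hex h_halt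
  have e : (exec K ε color choose (Nat.find hex) >>= terminationTest ε).ops =
      (exec K ε color choose (Nat.find hex)).ops + 2 := rfl
  have hmono := Finset.sum_le_sum_of_subset (f := fun s => 2 + c + blockCost K color (ℓ s))
    (Finset.range_mono hle)
  refine Nat.cast_le.2 ?_
  rw [e, exec_ops h hops]
  lia

lemma rounds_le {K : Matrix (Fin n) (Fin n) ℝ} {ε : ℝ} {color : Fin n → Fin p} {ℓ : ℕ → Fin p}
    {t : ℕ} (ht : IsEpsBalanced ε (scaling K (iterate K color ℓ t))) :
    rounds K ε color ℓ ≤ t := iInf₂_le t ht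

lemma sum_card_row (K : Matrix (Fin n) (Fin n) ℝ) :
    ∑ k, (Finset.univ.filter fun j => K k j ≠ 0).card = numNonzero K := by
  simp only [numNonzero, Finset.card_filter]
  rw [Fintype.sum_prod_type]

lemma sum_card_col (K : Matrix (Fin n) (Fin n) ℝ) :
    ∑ k, (Finset.univ.filter fun j => K j k ≠ 0).card = numNonzero K := by
  simp only [numNonzero, Finset.card_filter]
  rw [Fintype.sum_prod_type_right]

lemma card_le_numNonzero {K : Matrix (Fin n) (Fin n) ℝ} (hK : Admissible K) :
    n ≤ numNonzero K := by
  rw [← sum_card_row]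
  calc n = ∑ _k : Fin n, 1 := by simp
    _ ≤ _ := Finset.sum_le_sum fun k _ => Finset.card_pos.2 (by
      obtain ⟨j, hj⟩ := hK.row_ne k
      exact ⟨j, by simp [hj]⟩)

lemma IsColoring.card_le {K : Matrix (Fin n) (Fin n) ℝ} {color : Fin n → Fin p}
    (hc : IsColoring K color) : p ≤ n := by
  simpa using Fintype.card_le_of_surjective color hc.1

lemma sum_blockCost_le {K : Matrix (Fin n) (Fin n) ℝ} (hK : Admissible K)
    (color : Fin n → Fin p) : ∑ b, blockCost K color b ≤ 49 * numNonzero K := by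
  have h1 : ∑ b, blockCost K color b = ∑ k, vertexCost K k := by
    simp only [blockCost, Finset.sum_filter]
    rw [Finset.sum_comm]
    simp
  have h2 : ∑ k, (outNbrs K k).length ≤ numNonzero K := by
    rw [← sum_card_row]
    refine Finset.sum_le_sum fun k _ => ?_
    rw [outNbrs, Finset.length_toList]
    exact Finset.card_le_card fun j hj => by simp at hj ⊢; exact hj.2
  have h3 : ∑ k, (inNbrs K k).length ≤ numNonzero K := by
    rw [← sum_card_col]
    refine Finset.sum_le_sum fun k _ => ?_
    rw [inNbrs, Finset.length_toList]
    exact Finset.card_le_card fun j hj => by simp at hj ⊢; exact hj.2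
  have h4 := card_le_numNonzero hK
  rw [h1]
  simp only [vertexCost, Finset.sum_add_distrib, ← Finset.mul_sum, Finset.sum_const,
    Finset.card_univ, Fintype.card_fin, smul_eq_mul]
  lia

/-! ### The greedy choice -/

lemma computeImbalance_val {A : Matrix (Fin n) (Fin n) ℝ} {s : State n} (h : Represents A s)
    (color : Fin n → Fin p) (b : Fin p) :
    (computeImbalance color s b).val = blockImbalance A color b := by
  have key : ∀ (l : List (Fin n)) (g : ℝ), (l.foldlM (fun g k => do
      let y ← op (Real.sqrt (s.row k))
      let z ← op (Real.sqrt (s.col k))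
      let w ← op (y - z)
      let w' ← op (w ^ 2)
      op (g + w')) g).val =
        g + (l.map fun k => (Real.sqrt (s.row k) - Real.sqrt (s.col k)) ^ 2).sum := by
    intro l
    induction l with
    | nil => intro g; simp; rfl
    | cons k l ih =>
      intro g
      rw [List.map_cons, List.sum_cons, ← add_assoc]
      exact ih _
  rw [computeImbalance, key, zero_add, blockList, Finset.sum_map_toList, h.row, h.col]
  rfl

lemma computeImbalance_ops (color : Fin n → Fin p) (s : State n) (b : Fin p) :
    (computeImbalance color s b).ops = 5 * (Finset.univ.filter fun k => color k = b).card := by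
  rw [computeImbalance, foldlM_ops _ (fun _ => 5) (fun _ _ => rfl)]
  simp [blockList, mul_comm]

lemma computeImbalances_val {A : Matrix (Fin n) (Fin n) ℝ} {s : State n} (h : Represents A s)
    (color : Fin n → Fin p) : (computeImbalances color s).val = blockImbalance A color := by
  have key : ∀ (l : List (Fin p)) (g : Fin p → ℝ), (l.foldlM (fun g b => do
      let y ← computeImbalance color s b
      return Function.update g b y) g).val =
        fun b => if b ∈ l then blockImbalance A color b else g b := by
    intro l
    induction l with
    | nil => intro g; simp; rfl
    | cons c l ih =>
      intro g
      refine (ih (Function.update g c (computeImbalance color s c).val)).trans ?_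
      ext b
      by_cases hb : b = c
      · subst hb
        simp [computeImbalance_val h]
      · simp [hb]
  rw [computeImbalances, key]
  simp

lemma greedyChoice_ops (color : Fin n → Fin p) (sel : ℕ → (Fin p → ℝ) → Fin p) (t : ℕ)
    (s : State n) : (greedyChoice color sel t s).ops = 5 * n + p := by
  have h1 : (computeImbalances color s).ops = 5 * n := by
    rw [computeImbalances, foldlM_ops _
      (fun b => 5 * (Finset.univ.filter fun k => color k = b).card)
      (fun g b => by rw [← computeImbalance_ops]; rfl),
      ← Fin.sum_univ_def, ← Finset.mul_sum, Finset.sum_card_fiberwise_eq_card_filter]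
    simp
  have e : (greedyChoice color sel t s).ops = (computeImbalances color s).ops + p := rfl
  rw [e, h1]

lemma greedyChoice_val {A : Matrix (Fin n) (Fin n) ℝ} {s : State n} (h : Represents A s)
    (color : Fin n → Fin p) (sel : ℕ → (Fin p → ℝ) → Fin p) (t : ℕ) :
    (greedyChoice color sel t s).val = sel t (blockImbalance A color) := by
  rw [← computeImbalances_val h]
  rfl

end Implementation

/-! ### Stopped Markov chains driven by independent uniform choices -/

section FrozenRun

variable {α : Type} {X : Type*}

/-- The orbit of `x` under the maps `f (ℓ 0)`, `f (ℓ 1)`, …. -/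
def orbit (f : α → X → X) (x : X) (ℓ : ℕ → α) : ℕ → X
  | 0 => x
  | t + 1 => f (ℓ t) (orbit f x ℓ t)

open Classical in
/-- One step of the chain with accumulated cost, frozen as soon as `halted` holds. -/
def frozenStep (f : α → X → X) (w : α → ℝ) (halted : X → Prop) (a : α) (r : X × ℝ) : X × ℝ :=
  if halted r.1 then r else (f a r.1, r.2 + w a)

/-- The chain with accumulated cost, frozen as soon as `halted` holds. -/
def frozenRun (f : α → X → X) (w : α → ℝ) (halted : X → Prop) (x : X) (ℓ : ℕ → α) : ℕ → X × ℝ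
  | 0 => (x, 0)
  | t + 1 => frozenStep f w halted (ℓ t) (frozenRun f w halted x ℓ t)

lemma frozenRun_congr (f : α → X → X) (w : α → ℝ) (halted : X → Prop) (x : X) {ℓ ℓ' : ℕ → α}
    {t : ℕ} (h : ∀ s < t, ℓ s = ℓ' s) : frozenRun f w halted x ℓ t = frozenRun f w halted x ℓ' t := by
  induction t with
  | zero => rfl
  | succ t ih =>
    rw [frozenRun, frozenRun, ih fun s hs => h s (hs.trans t.lt_succ_self), h t t.lt_succ_self]

lemma frozenRun_eq_orbit (f : α → X → X) (w : α → ℝ) (halted : X → Prop) (x : X) (ℓ : ℕ → α)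
    (t : ℕ) (h : ∀ s < t, ¬ halted (orbit f x ℓ s)) :
    frozenRun f w halted x ℓ t = (orbit f x ℓ t, ∑ s ∈ Finset.range t, w (ℓ s)) := by
  induction t with
  | zero => simp [frozenRun, orbit]
  | succ t ih =>
    rw [frozenRun, ih fun s hs => h s (hs.trans t.lt_succ_self), frozenStep,
      if_neg (h t t.lt_succ_self), Finset.sum_range_succ, orbit]

lemma frozenRun_cost_monotone (f : α → X → X) {w : α → ℝ} (hw : ∀ a, 0 ≤ w a) (halted : X → Prop)
    (x : X) (ℓ : ℕ → α) : Monotone fun t => (frozenRun f w halted x ℓ t).2 :=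
  monotone_nat_of_le_succ fun t => by
    rw [frozenRun, frozenStep]
    split_ifs
    · exact le_rfl
    · exact le_add_of_nonneg_right (hw _)

lemma frozenRun_invariant {f : α → X → X} (w : α → ℝ) (halted : X → Prop) {I : X → Prop}
    (hI : ∀ x a, I x → I (f a x)) {x : X} (hx : I x) (ℓ : ℕ → α) (t : ℕ) :
    I (frozenRun f w halted x ℓ t).1 := by
  induction t with
  | zero => exact hx
  | succ t ih =>
    rw [frozenRun, frozenStep]
    split_ifs
    · exact ih
    · exact hI _ _ ih

end FrozenRun

section Probability

open MeasureTheory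

variable {Ω : Type u} [MeasurableSpace Ω] {μ : Measure Ω} {α : Type} [Fintype α] {ξ : ℕ → Ω → α}

lemma measurable_of_eq_on_lt {β : Type*} [MeasurableSpace β] (hξ : IsIIDUniform μ ξ) [Nonempty α]
    (N : ℕ) (F : (ℕ → α) → β) (hF : ∀ ℓ ℓ' : ℕ → α, (∀ t < N, ℓ t = ℓ' t) → F ℓ = F ℓ') :
    Measurable fun ω => F fun t => ξ t ω := by
  let _ : MeasurableSpace α := ⊤
  have _ : DiscreteMeasurableSpace α := ⟨fun _ => trivial⟩
  let a0 : α := Classical.arbitrary α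
  have e : (fun ω => F fun t => ξ t ω) =
      (fun v : Fin N → α => F fun t => if h : t < N then v ⟨t, h⟩ else a0) ∘
        fun ω (i : Fin N) => ξ i ω := by
    funext ω
    exact hF _ _ fun t ht => by simp [ht]
  rw [e]
  exact Measurable.of_discrete.comp (measurable_pi_lambda _ fun i => hξ.measurable i)

/-- The choice in round `N` is uniform given the earlier ones. -/
lemma lintegral_step [IsProbabilityMeasure μ] (hξ : IsIIDUniform μ ξ) (N : ℕ)
    (F : α → (ℕ → α) → ℝ≥0∞)
    (hF : ∀ a (ℓ ℓ' : ℕ → α), (∀ t < N, ℓ t = ℓ' t) → F a ℓ = F a ℓ') :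
    ∫⁻ ω, F (ξ N ω) (fun t => ξ t ω) ∂μ =
      ∫⁻ ω, ((Fintype.card α : ℕ) : ℝ≥0∞)⁻¹ * ∑ a, F a (fun t => ξ t ω) ∂μ := by
  classical
  let _ : MeasurableSpace α := ⊤
  have _ : DiscreteMeasurableSpace α := ⟨fun _ => trivial⟩
  have _ : Nonempty Ω := nonempty_of_isProbabilityMeasure μ
  have _ : Nonempty α := ⟨ξ 0 (Classical.arbitrary Ω)⟩
  have hmF : ∀ a, Measurable fun ω => F a fun t => ξ t ω := fun a =>
    measurable_of_eq_on_lt hξ N (F a) (hF a)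
  have hmI : ∀ a, Measurable fun ω => if ξ N ω = a then (1 : ℝ≥0∞) else 0 := fun a =>
    (Measurable.of_discrete (f := fun b : α => if b = a then (1 : ℝ≥0∞) else 0)).comp
      (hξ.measurable N)
  have h1 : ∀ ω, F (ξ N ω) (fun t => ξ t ω) =
      ∑ a, F a (fun t => ξ t ω) * if ξ N ω = a then (1 : ℝ≥0∞) else 0 := fun ω => by simp
  have hmFI : ∀ a, Measurable fun ω => F a (fun t => ξ t ω) * if ξ N ω = a then (1 : ℝ≥0∞) else 0 :=
    fun a => (hmF a).mul (hmI a)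
  simp_rw [h1]
  rw [lintegral_finsetSum _ fun a _ => hmFI a, lintegral_const_mul _
    (Finset.measurable_fun_sum _ fun a _ => hmF a), lintegral_finsetSum _ fun a _ => hmF a,
    Finset.mul_sum]
  refine Finset.sum_congr rfl fun a _ => ?_
  have hind : ProbabilityTheory.IndepFun (fun ω => F a fun t => ξ t ω)
      (fun ω => if ξ N ω = a then (1 : ℝ≥0∞) else 0) μ := by
    have h := hξ.indep.indepFun_finset (Finset.range N) {N} (by simp) fun i => hξ.measurable i
    have e1 : (fun ω => F a fun t => ξ t ω) =
        (fun v : Finset.range N → α =>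
          F a fun t => if h : t ∈ Finset.range N then v ⟨t, h⟩ else a) ∘
          fun ω (i : Finset.range N) => ξ i ω := by
      ext ω
      exact hF a _ _ fun t ht => by simp [ht]
    have e2 : (fun ω => if ξ N ω = a then (1 : ℝ≥0∞) else 0) =
        (fun v : ({N} : Finset ℕ) → α => if v ⟨N, by simp⟩ = a then (1 : ℝ≥0∞) else 0) ∘
          fun ω (i : ({N} : Finset ℕ)) => ξ i ω := rfl
    rw [e1, e2]
    exact h.comp Measurable.of_discrete Measurable.of_discrete
  have hmul :=
    ProbabilityTheory.lintegral_mul_eq_lintegral_mul_lintegral_of_indepFun (hmF a) (hmI a) hind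
  simp only [Pi.mul_apply] at hmul
  rw [hmul, mul_comm]
  congr 1
  have e : (fun ω => if ξ N ω = a then (1 : ℝ≥0∞) else 0) =
      Set.indicator {ω | ξ N ω = a} 1 := by
    ext ω
    simp [Set.indicator_apply]
  have hmeas : MeasurableSet {ω | ξ N ω = a} := hξ.measurable N (measurableSet_singleton a)
  rw [e, ← hξ.uniform N a]
  exact lintegral_indicator_one hmeas

variable {X : Type*}

/-- If `Z` times the exponential of the cost does not increase on average, its expectation along the
frozen chain stays below the initial value. -/
lemma lintegral_frozenRun_le [IsProbabilityMeasure μ] (hξ : IsIIDUniform μ ξ) {f : α → X → X}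
    {w : α → ℝ} {halted : X → Prop} {I : X → Prop} (hI : ∀ x a, I x → I (f a x)) {x : X} (hx : I x)
    {Z : X → ℝ} {θ : ℝ} (hZ0 : ∀ x, I x → 0 ≤ Z x)
    (hZ : ∀ x, I x → ¬ halted x →
      ∑ a, Real.exp (θ * w a) * Z (f a x) ≤ Fintype.card α * Z x) (N : ℕ) :
    ∫⁻ ω, ENNReal.ofReal (Real.exp (θ * (frozenRun f w halted x (fun t => ξ t ω) N).2) *
      Z (frozenRun f w halted x (fun t => ξ t ω) N).1) ∂μ ≤ ENNReal.ofReal (Z x) := by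
  have _ : Nonempty Ω := nonempty_of_isProbabilityMeasure μ
  have _ : Nonempty α := ⟨ξ 0 (Classical.arbitrary Ω)⟩
  have hcard : (0 : ℝ) < Fintype.card α := by exact_mod_cast Fintype.card_pos
  induction N with
  | zero => simp [frozenRun]
  | succ N ih =>
    refine le_trans ?_ ih
    have hstep := lintegral_step hξ N (fun a ℓ =>
      ENNReal.ofReal (Real.exp (θ * (frozenStep f w halted a (frozenRun f w halted x ℓ N)).2) *
        Z (frozenStep f w halted a (frozenRun f w halted x ℓ N)).1))
      (fun a ℓ ℓ' h => by simp only [frozenRun_congr f w halted x h])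
    simp only [frozenRun]
    rw [hstep]
    refine lintegral_mono fun ω => ?_
    have hIr := frozenRun_invariant w halted hI hx (fun t => ξ t ω) N
    set r := frozenRun f w halted x (fun t => ξ t ω) N with hr
    have hc : ((Fintype.card α : ℕ) : ℝ≥0∞) = ENNReal.ofReal (Fintype.card α) := by simp
    have hnn : ∀ a, 0 ≤ Real.exp (θ * (frozenStep f w halted a r).2) *
        Z (frozenStep f w halted a r).1 := fun a => by
      refine mul_nonneg (Real.exp_pos _).le (hZ0 _ ?_)
      rw [frozenStep]
      split_ifs
      exacts [hIr, hI _ _ hIr]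
    dsimp only
    rw [← ENNReal.ofReal_sum_of_nonneg fun a _ => hnn a, hc, ← ENNReal.ofReal_inv_of_pos hcard,
      ← ENNReal.ofReal_mul (by positivity)]
    refine ENNReal.ofReal_le_ofReal ?_
    rw [inv_mul_le_iff₀ hcard]
    by_cases hs : halted r.1
    · simp [frozenStep, hs]
    · simp only [frozenStep, hs, if_false]
      have := mul_le_mul_of_nonneg_left (hZ r.1 hIr hs) (Real.exp_pos (θ * r.2)).le
      rw [Finset.mul_sum] at this
      refine le_trans (le_of_eq (Finset.sum_congr rfl fun a _ => ?_)) (this.trans (le_of_eq ?_))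
      · rw [mul_add, Real.exp_add, mul_assoc]
      · ring

/-- A bound on the exponential moments gives bounds in expectation and with high probability. The
cost `c N` is that of the first `N` steps. -/
lemma boundedInExpectationAndWHP_of_exp [IsProbabilityMeasure μ] {c : ℕ → Ω → ℝ}
    (hm : ∀ N, Measurable (c N)) (hmono : ∀ ω, Monotone fun N => c N ω) {θ b C B : ℝ} (hθ : 0 < θ)
    (hb0 : 0 ≤ b) (hb : θ * b ≤ 1) (hexp : ∀ N, ∫⁻ ω, ENNReal.ofReal (Real.exp (θ * c N ω)) ∂μ ≤ 2)
    {T : Ω → ℕ∞} (hT : ∀ ω, ((T ω : ℕ∞) : ℝ≥0∞) ≤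
      ENNReal.ofReal b + ⨆ N, ENNReal.ofReal (c N ω)) (hCB : 4 ≤ θ * (C * B)) :
    BoundedInExpectationAndWHP μ T C B := by
  have hb' : b ≤ 1 / θ := by rw [le_div_iff₀ hθ]; linarith
  have hCB' : 4 / θ ≤ C * B := by rw [div_le_iff₀ hθ]; linarith
  constructor
  · calc ∫⁻ ω, ((T ω : ℕ∞) : ℝ≥0∞) ∂μ
        ≤ ∫⁻ ω, (ENNReal.ofReal b + ⨆ N, ENNReal.ofReal (c N ω)) ∂μ := lintegral_mono hT
      _ = ENNReal.ofReal b + ⨆ N, ∫⁻ ω, ENNReal.ofReal (c N ω) ∂μ := by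
          rw [lintegral_add_left measurable_const, lintegral_const, measure_univ, mul_one,
            lintegral_iSup (fun N => (hm N).ennreal_ofReal)
              (fun N N' h ω => ENNReal.ofReal_le_ofReal (hmono ω h))]
      _ ≤ ENNReal.ofReal (1 / θ) + ENNReal.ofReal (1 / θ) * 2 := by
          refine add_le_add (ENNReal.ofReal_le_ofReal hb') (iSup_le fun N => ?_)
          refine le_trans ?_ (mul_le_mul_right (hexp N) _)
          rw [← lintegral_const_mul _ ((hm N).const_mul θ).exp.ennreal_ofReal]
          refine lintegral_mono fun ω => ?_
          dsimp only
          rw [← ENNReal.ofReal_mul (by positivity)]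
          refine ENNReal.ofReal_le_ofReal ?_
          rw [one_div_mul_eq_div, le_div_iff₀ hθ]
          linarith [Real.add_one_le_exp (θ * c N ω)]
      _ = ENNReal.ofReal (3 / θ) := by
          rw [show (2 : ℝ≥0∞) = ENNReal.ofReal 2 by simp, ← ENNReal.ofReal_mul (by positivity),
            ← ENNReal.ofReal_add (by positivity) (by positivity)]
          congr 1
          ring
      _ ≤ ENNReal.ofReal (C * B) := ENNReal.ofReal_le_ofReal
          (le_trans (div_le_div_of_nonneg_right (by norm_num) hθ.le) hCB')
  · intro δ hδ hδ2
    set lg := Real.log (1 / δ) with hlg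
    have hlg1 : 1 / 2 ≤ lg := by
      have h2 : (2 : ℝ) ≤ 1 / δ := by rw [le_div_iff₀ hδ]; linarith
      have := Real.log_le_log two_pos h2
      linarith [Real.log_two_gt_d9]
    set y := 2 * lg / θ with hy
    have hy0 : 0 ≤ y := by positivity
    have hθy : Real.exp (θ * y) = (1 / δ) ^ 2 := by
      rw [hy, mul_div_cancel₀ _ hθ.ne', mul_comm, Real.exp_mul, hlg, Real.exp_log (by positivity)]
      norm_num
    have hbadN : ∀ N, μ {ω | y < c N ω} ≤ ENNReal.ofReal δ := by
      intro N
      have h1 := mul_meas_ge_le_lintegral (μ := μ) ((hm N).const_mul θ).exp.ennreal_ofReal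
        (ENNReal.ofReal ((1 / δ) ^ 2))
      have hsub : {ω | y < c N ω} ⊆ {ω | ENNReal.ofReal ((1 / δ) ^ 2) ≤
          ENNReal.ofReal (Real.exp (θ * c N ω))} := fun ω (hω : y < c N ω) => by
        rw [Set.mem_ofPred_eq, ← hθy]
        exact ENNReal.ofReal_le_ofReal (Real.exp_le_exp.2 (by gcongr))
      have h2 := (mul_le_mul_right (measure_mono hsub) _).trans (h1.trans (hexp N))
      calc μ {ω | y < c N ω}
          = ENNReal.ofReal (δ ^ 2) * (ENNReal.ofReal ((1 / δ) ^ 2) * μ {ω | y < c N ω}) := by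
            rw [← mul_assoc, ← ENNReal.ofReal_mul (by positivity)]
            have : δ ^ 2 * (1 / δ) ^ 2 = 1 := by field_simp
            rw [this, ENNReal.ofReal_one, one_mul]
        _ ≤ ENNReal.ofReal (δ ^ 2) * 2 := mul_le_mul_right h2 _
        _ = ENNReal.ofReal (δ ^ 2 * 2) := by
            rw [ENNReal.ofReal_mul (by positivity)]
            simp
        _ ≤ ENNReal.ofReal δ := ENNReal.ofReal_le_ofReal (by nlinarith)
    have hbad : μ (⋃ N, {ω | y < c N ω}) ≤ ENNReal.ofReal δ := by
      have hbm : Monotone fun N => {ω | y < c N ω} := fun N N' h ω (hω : y < c N ω) =>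
        show y < c N' ω from hω.trans_le (hmono ω h)
      rw [hbm.measure_iUnion]
      exact iSup_le hbadN
    have hmeas : MeasurableSet (⋃ N, {ω | y < c N ω}) :=
      MeasurableSet.iUnion fun N => measurableSet_lt measurable_const (hm N)
    calc ENNReal.ofReal (1 - δ) = 1 - ENNReal.ofReal δ := by
          rw [ENNReal.ofReal_sub _ hδ.le, ENNReal.ofReal_one]
      _ ≤ 1 - μ (⋃ N, {ω | y < c N ω}) := tsub_le_tsub_left hbad _
      _ = μ (⋃ N, {ω | y < c N ω})ᶜ := (prob_compl_eq_one_sub hmeas).symm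
      _ ≤ _ := measure_mono fun ω hω => ?_
    simp only [Set.mem_compl_iff, Set.mem_iUnion, Set.mem_ofPred_eq, not_exists, not_lt] at hω ⊢
    refine (hT ω).trans ?_
    calc ENNReal.ofReal b + ⨆ N, ENNReal.ofReal (c N ω)
        ≤ ENNReal.ofReal b + ENNReal.ofReal y :=
          add_le_add le_rfl (iSup_le fun N => ENNReal.ofReal_le_ofReal (hω N))
      _ = ENNReal.ofReal (b + y) := (ENNReal.ofReal_add hb0 hy0).symm
      _ ≤ _ := ENNReal.ofReal_le_ofReal ?_
    have h3 : 1 / θ ≤ 2 * lg / θ := div_le_div_of_nonneg_right (by linarith) hθ.le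
    calc b + y ≤ 2 * lg / θ + 2 * lg / θ := by linarith
      _ = 4 / θ * lg := by ring
      _ ≤ C * B * lg := by gcongr
      _ = C * (B * lg) := by ring

/-- A chain whose potential `W`, with values in `[0, M]`, drops on average by `1` per step, stops
after `O(M)` steps, and its total cost is `O(M)` times the average cost of a step, both in expectation and
with exponential tails. -/
theorem boundedInExpectationAndWHP_of_potential [IsProbabilityMeasure μ] (hξ : IsIIDUniform μ ξ)
    {f : α → X → X} {w : α → ℝ} {halted : X → Prop} {I : X → Prop} (hI : ∀ x a, I x → I (f a x))
    {x : X} (hx : I x) {W : X → ℝ} {M b C B : ℝ} (hM : 0 < M) (hCB : 0 < C * B)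
    (hW0 : ∀ x, I x → 0 ≤ W x) (hWM : ∀ x, I x → W x ≤ M)
    (hW : ∀ x, I x → ¬ halted x → ∑ a, W (f a x) ≤ Fintype.card α * (W x - 1))
    (hw1 : ∀ a, 1 ≤ w a) (hwB : ∀ a, 4 * w a ≤ C * B)
    (hwM : 16 * M * ∑ a, w a ≤ Fintype.card α * (C * B)) (hb0 : 0 ≤ b) (hbB : 4 * b ≤ C * B)
    {T : Ω → ℕ∞} (hT : ∀ ω t, halted (orbit f x (fun t => ξ t ω) t) →
      ((T ω : ℕ∞) : ℝ≥0∞) ≤ ENNReal.ofReal (b + ∑ s ∈ Finset.range t, w (ξ s ω))) :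
    BoundedInExpectationAndWHP μ T C B := by
  -- `θ⁻¹` is the scale of the total cost
  obtain ⟨θ, hθ, hθB⟩ : ∃ θ : ℝ, 0 < θ ∧ θ * (C * B) = 4 :=
    ⟨4 / (C * B), by positivity, div_mul_cancel₀ _ hCB.ne'⟩
  have hθw : ∀ a, θ * w a ≤ 1 := fun a => by nlinarith [hwB a]
  have hθM : 4 * θ * M * ∑ a, w a ≤ Fintype.card α := by
    have := mul_le_mul_of_nonneg_left hwM hθ.le
    have e : θ * (Fintype.card α * (C * B)) = Fintype.card α * 4 := by rw [← hθB]; ring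
    linarith
  have hb : θ * b ≤ 1 := by nlinarith
  have _ : Nonempty Ω := nonempty_of_isProbabilityMeasure μ
  have _ : Nonempty α := ⟨ξ 0 (Classical.arbitrary Ω)⟩
  have hw0 : ∀ a, 0 ≤ w a := fun a => zero_le_one.trans (hw1 a)
  have hZ1 : ∀ x, I x → 1 ≤ 1 + W x / M := fun x hx => by
    have := div_nonneg (hW0 x hx) hM.le
    linarith
  have hZ2 : ∀ x, I x → 1 + W x / M ≤ 2 := fun x hx => by
    have := (div_le_one hM).2 (hWM x hx)
    linarith
  have hstep : ∀ x, I x → ¬ halted x →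
      ∑ a, Real.exp (θ * w a) * (1 + W (f a x) / M) ≤ Fintype.card α * (1 + W x / M) := by
    intro x hx hs
    have h1 : ∀ a, Real.exp (θ * w a) * (1 + W (f a x) / M) ≤
        1 + W (f a x) / M + 4 * θ * w a := by
      intro a
      have hy0 : 0 ≤ θ * w a := mul_nonneg hθ.le (hw0 a)
      have he : Real.exp (θ * w a) - 1 ≤ 2 * (θ * w a) := by
        have := Real.abs_exp_sub_one_le (x := θ * w a) (by rw [abs_of_nonneg hy0]; exact hθw a)
        rw [abs_of_nonneg hy0] at this
        exact (le_abs_self _).trans this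
      have h2 := hZ2 _ (hI x a hx)
      have h3 := hZ1 _ (hI x a hx)
      nlinarith
    refine (Finset.sum_le_sum fun a _ => h1 a).trans ?_
    rw [Finset.sum_add_distrib, Finset.sum_add_distrib, ← Finset.sum_div, ← Finset.mul_sum,
      Finset.sum_const, Finset.card_univ, nsmul_eq_mul, mul_one]
    have h4 := div_le_div_of_nonneg_right (hW x hx hs) hM.le
    have h5 : 4 * θ * ∑ a, w a ≤ Fintype.card α / M := by
      rw [le_div_iff₀ hM]
      linarith
    have e : (Fintype.card α : ℝ) * (W x - 1) / M =
        Fintype.card α * (W x / M) - Fintype.card α / M := by ring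
    linarith
  refine boundedInExpectationAndWHP_of_exp
    (c := fun N ω => (frozenRun f w halted x (fun t => ξ t ω) N).2)
    (fun N => measurable_of_eq_on_lt hξ N (fun ℓ => (frozenRun f w halted x ℓ N).2)
      fun ℓ ℓ' h => by rw [frozenRun_congr f w halted x h])
    (fun ω => frozenRun_cost_monotone f hw0 halted x _) hθ hb0 hb (fun N => ?_) (fun ω => ?_) hθB.ge
  · calc _ ≤ ∫⁻ ω, ENNReal.ofReal (Real.exp (θ * (frozenRun f w halted x (fun t => ξ t ω) N).2) *
          (1 + W (frozenRun f w halted x (fun t => ξ t ω) N).1 / M)) ∂μ :=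
          lintegral_mono fun ω => ENNReal.ofReal_le_ofReal
            (le_mul_of_one_le_right (Real.exp_pos _).le
              (hZ1 _ (frozenRun_invariant w halted hI hx _ N)))
      _ ≤ ENNReal.ofReal (1 + W x / M) :=
          lintegral_frozenRun_le hξ hI hx (Z := fun x => 1 + W x / M)
            (fun x hx => zero_le_one.trans (hZ1 x hx)) hstep N
      _ ≤ ENNReal.ofReal 2 := ENNReal.ofReal_le_ofReal (hZ2 x hx)
      _ = 2 := by simp
  · classical
    by_cases h : ∃ t, halted (orbit f x (fun t => ξ t ω) t)
    · have hrun := frozenRun_eq_orbit f w halted x (fun t => ξ t ω) (Nat.find h)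
        fun s hs => Nat.find_min h hs
      refine (hT ω _ (Nat.find_spec h)).trans ?_
      rw [ENNReal.ofReal_add hb0 (Finset.sum_nonneg fun _ _ => hw0 _)]
      refine add_le_add le_rfl (le_trans (le_of_eq ?_) (le_iSup _ (Nat.find h)))
      rw [hrun]
    · push Not at h
      -- if the chain never stops, the accumulated costs are unbounded
      have htop : ⨆ N, ENNReal.ofReal (frozenRun f w halted x (fun t => ξ t ω) N).2 = ⊤ := by
        refine ENNReal.eq_top_of_forall_nnreal_le fun r => ?_
        obtain ⟨N, hN⟩ := exists_nat_ge (r : ℝ)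
        refine le_trans ?_ (le_iSup _ N)
        rw [frozenRun_eq_orbit f w halted x _ N fun s _ => h s, ← ENNReal.ofReal_coe_nnreal]
        refine ENNReal.ofReal_le_ofReal (hN.trans ?_)
        calc (N : ℝ) = ∑ _s ∈ Finset.range N, (1 : ℝ) := by simp
          _ ≤ _ := Finset.sum_le_sum fun s _ => hw1 _
      rw [htop, add_top]
      exact le_top

end Probability

/-! ### Convergence of the three variants -/

section Convergence

open MeasureTheory

variable {n p : ℕ} {K : Matrix (Fin n) (Fin n) ℝ}

lemma isEpsBalanced_of_not [NeZero n] (hK : Admissible K) {ε : ℝ} (hε : 0 < ε)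
    (h : ¬ (2 ≤ n ∧ ε ≤ 2)) : IsEpsBalanced ε K := by
  rw [IsEpsBalanced, div_le_iff₀ hK.total_pos]
  by_cases hn : 2 ≤ n
  · have hε2 : 2 < ε := by
      by_contra! h2
      exact h ⟨hn, h2⟩
    exact hK.sum_abs_le.trans (mul_le_mul_of_nonneg_right hε2.le hK.total_pos.le)
  · obtain rfl : n = 1 := by
      have := NeZero.ne n
      lia
    have : ∑ i, |rowSum K i - colSum K i| = 0 := by simp [rowSum, colSum]
    rw [this]
    exact mul_nonneg hε.le hK.total_pos.le

lemma rounds_eq_zero {ε : ℝ} (h : IsEpsBalanced ε K) (color : Fin n → Fin p) (ℓ : ℕ → Fin p) :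
    rounds K ε color ℓ = 0 := by
  have h0 : IsEpsBalanced ε (scaling K (iterate K color ℓ 0)) := by rwa [iterate, scaling_zero]
  simpa using rounds_le h0

lemma BoundedInExpectationAndWHP.of_eq_zero {Ω : Type u} [MeasurableSpace Ω] {μ : Measure Ω}
    [IsProbabilityMeasure μ] {T : Ω → ℕ∞} (hT : ∀ ω, T ω = 0) (C B : ℝ) :
    BoundedInExpectationAndWHP μ T C B := by
  refine ⟨by simp [hT], fun δ hδ _ => ?_⟩
  simp only [hT, ENat.toENNReal_zero, zero_le]
  have : {_ω : Ω | True} = Set.univ := rfl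
  rw [this, measure_univ]
  exact ENNReal.ofReal_le_one.2 (by linarith)

/-- The potential of Block Osborne when rounds (or cycles) are expected to decrease the sum of the
entries by `γ` times the squared imbalances. -/
def osbornePotential (K : Matrix (Fin n) (Fin n) ℝ) (ε γ : ℝ) (xs x : Fin n → ℝ) : ℝ :=
  potential (16 / γ) ε (gapSlope K) (gap K xs x)

lemma osbornePotential_nonneg (hn : 2 ≤ n) (hK : Admissible K) {ε γ : ℝ} (hε : 0 < ε) (hγ : 0 < γ)
    {xs : Fin n → ℝ} (hxs : rowSum (scaling K xs) = colSum (scaling K xs)) (x : Fin n → ℝ) :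
    0 ≤ osbornePotential K ε γ xs x := by
  have : NeZero n := ⟨by lia⟩
  exact potential_nonneg (by positivity) hε (gapSlope_nonneg hn hK) (gap_nonneg hK hxs x)

lemma osbornePotential_le (hn : 2 ≤ n) (hK : Admissible K) {ε γ : ℝ} (hε : 0 < ε) (hγ : 0 < γ)
    {xs x : Fin n → ℝ} (hxs : rowSum (scaling K xs) = colSum (scaling K xs))
    (hx : total (scaling K x) ≤ total K) :
    osbornePotential K ε γ xs x ≤ 2 * (16 / γ) * baseRate K ε := by
  have : NeZero n := ⟨by lia⟩
  exact potential_le hn hK (by positivity) hε (gap_nonneg hK hxs x)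
    (gap_le_log_condNumber hK xs hx)

/-- The block of largest imbalance has at least the average imbalance. -/
lemma exists_greedy_time (hn : 2 ≤ n) (hp : 0 < p) (hK : Admissible K) (hb : Balanceable K) {ε : ℝ}
    (hε : 0 < ε) {color : Fin n → Fin p} (hc : IsColoring K color) {ℓ : ℕ → Fin p}
    (hℓ : IsGreedy K color ℓ) :
    ∃ t : ℕ, IsEpsBalanced ε (scaling K (iterate K color ℓ t)) ∧
      (t : ℝ) ≤ 32 * (p * baseRate K ε) := by
  classical
  obtain ⟨xs, hxs⟩ := hb
  have hp0 : (0 : ℝ) < p := by exact_mod_cast hp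
  have hγ : (0 : ℝ) < 1 / p := by positivity
  set W := osbornePotential K ε (1 / p) xs with hW
  have hI : ∀ t, total (scaling K (iterate K color ℓ t)) ≤ total K := fun t => by
    have := total_runFrom_antitone hK hc ℓ 0 (Nat.zero_le t)
    simp only [← iterate_eq_runFrom] at this
    rwa [iterate, scaling_zero] at this
  have hmain : ∀ t : ℕ, (∀ s < t, ¬ IsEpsBalanced ε (scaling K (iterate K color ℓ s))) →
      W (iterate K color ℓ t) ≤ W 0 - t := by
    intro t
    induction t with
    | zero => intro; simp [iterate]
    | succ t ih =>
      intro h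
      have h1 := ih fun s hs => h s (hs.trans t.lt_succ_self)
      have h2 := total_blockUpdate_le hK hc (ℓ t) (iterate K color ℓ t)
      have h3 := sum_potential_le (α := Unit) hn hK hε hγ hxs (hI t) (h t t.lt_succ_self)
        (fun _ => iterate K color ℓ (t + 1))
        (fun _ => by
          rw [iterate]
          linarith [blockImbalance_nonneg (scaling K (iterate K color ℓ t)) color (ℓ t)])
        (by
          have h4 : ∑ k, vertexImbalance (scaling K (iterate K color ℓ t)) k ^ 2 ≤
              p * blockImbalance (scaling K (iterate K color ℓ t)) color (ℓ t) := by
            rw [← sum_blockImbalance _ color]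
            refine (Finset.sum_le_sum fun b _ => hℓ t b).trans (le_of_eq ?_)
            simp
          have h5 := mul_le_mul_of_nonneg_left h4 hγ.le
          rw [← mul_assoc, one_div_mul_cancel hp0.ne', one_mul] at h5
          simp only [Fintype.card_unit, Nat.cast_one, one_mul, Finset.univ_unique,
            Finset.sum_const, Finset.card_singleton, one_smul]
          rw [iterate]
          linarith)
      simp only [Fintype.card_unit, Nat.cast_one, one_mul, Finset.univ_unique,
        Finset.sum_const, Finset.card_singleton, one_smul] at h3
      have h6 : W (iterate K color ℓ (t + 1)) ≤ W (iterate K color ℓ t) - 1 := h3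
      push_cast
      linarith
  have hW0 : W 0 ≤ 32 * (p * baseRate K ε) := by
    have := osbornePotential_le (x := 0) hn hK hε hγ hxs (by rw [scaling_zero])
    refine this.trans (le_of_eq ?_)
    rw [one_div, div_inv_eq_mul]
    ring
  have hex : ∃ t, IsEpsBalanced ε (scaling K (iterate K color ℓ t)) := by
    by_contra! h
    obtain ⟨N, hN⟩ := exists_nat_gt (W 0)
    have h1 := hmain N fun s _ => h s
    have h2 := osbornePotential_nonneg hn hK hε hγ hxs (iterate K color ℓ N)
    rw [← hW] at h2
    linarith
  refine ⟨Nat.find hex, Nat.find_spec hex, ?_⟩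
  have h1 := hmain (Nat.find hex) fun s hs => Nat.find_min hex hs
  have h2 := osbornePotential_nonneg hn hK hε hγ hxs (iterate K color ℓ (Nat.find hex))
  rw [← hW] at h2
  linarith

lemma natCast_toENNReal (t : ℕ) : (((t : ℕ∞)) : ℝ≥0∞) = ENNReal.ofReal (t : ℝ) := by simp

lemma greedy_rounds_le (hn : 2 ≤ n) (hp : 0 < p) (hK : Admissible K) (hb : Balanceable K) {ε : ℝ}
    (hε : 0 < ε) {color : Fin n → Fin p} (hc : IsColoring K color) {ℓ : ℕ → Fin p}
    (hℓ : IsGreedy K color ℓ) :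
    ((rounds K ε color ℓ : ℕ∞) : ℝ≥0∞) ≤ ENNReal.ofReal (32 * (p * baseRate K ε)) := by
  obtain ⟨t, ht, hle⟩ := exists_greedy_time hn hp hK hb hε hc hℓ
  calc ((rounds K ε color ℓ : ℕ∞) : ℝ≥0∞) ≤ ((t : ℕ∞) : ℝ≥0∞) :=
        ENat.toENNReal_mono (rounds_le ht)
    _ = ENNReal.ofReal t := natCast_toENNReal t
    _ ≤ _ := ENNReal.ofReal_le_ofReal hle

lemma exists_greedy_implements [NeZero n] (hK : Admissible K) (ε : ℝ) {color : Fin n → Fin p}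
    (hc : IsColoring K color) {sel : ℕ → (Fin p → ℝ) → Fin p}
    (hsel : ∀ (t : ℕ) (g : Fin p → ℝ) (b : Fin p), g b ≤ g (sel t g)) :
    ∃ ℓ : ℕ → Fin p, IsGreedy K color ℓ ∧
      (∀ t, (greedyChoice color sel t (exec K ε color (greedyChoice color sel) t).val).val = ℓ t) ∧
      Implements K ε color (greedyChoice color sel) ℓ := by
  refine ⟨fun t => (greedyChoice color sel t (exec K ε color (greedyChoice color sel) t).val).val,
    fun t b => ?_, fun _ => rfl, implements_of_choose hK hc fun _ => rfl⟩
  have hr := (exec_spec (ε := ε) hc (choose := greedyChoice color sel) (fun _ => rfl) t).2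
  beta_reduce at hr ⊢
  rw [greedyChoice_val hr]
  exact hsel t _ b

lemma blockCost_le (hK : Admissible K) (color : Fin n → Fin p) (b : Fin p) :
    blockCost K color b ≤ 49 * numNonzero K :=
  (Finset.single_le_sum (f := blockCost K color) (fun _ _ => Nat.zero_le _)
    (Finset.mem_univ b)).trans (sum_blockCost_le hK color)

lemma greedy_work_le (hn : 2 ≤ n) (hp : 0 < p) (hK : Admissible K) (hb : Balanceable K) {ε : ℝ}
    (hε : 0 < ε) (hε2 : ε ≤ 2) {color : Fin n → Fin p} (hc : IsColoring K color)
    {sel : ℕ → (Fin p → ℝ) → Fin p}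
    (hsel : ∀ (t : ℕ) (g : Fin p → ℝ) (b : Fin p), g b ≤ g (sel t g)) :
    ((work K ε color (greedyChoice color sel) : ℕ∞) : ℝ≥0∞) ≤
      ENNReal.ofReal (2000 * (numNonzero K * p * baseRate K ε)) := by
  have : NeZero n := ⟨by lia⟩
  obtain ⟨ℓ, hℓ, hch, himp⟩ := exists_greedy_implements hK ε hc hsel
  obtain ⟨t, ht, hle⟩ := exists_greedy_time hn hp hK hb hε hc hℓ
  have hw := work_le himp hch (fun t s => greedyChoice_ops color sel t s) ht
  have hR := baseRate_ge hn hK hε hε2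
  have hnm := card_le_numNonzero hK
  have hpn := hc.card_le
  refine (ENat.toENNReal_mono hw).trans ?_
  rw [natCast_toENNReal]
  refine ENNReal.ofReal_le_ofReal ?_
  set m := numNonzero K with hm
  have h1 : 15 * m + 2 + ∑ s ∈ Finset.range t, (2 + (5 * n + p) + blockCost K color (ℓ s)) ≤
      16 * m + t * (56 * m) := by
    have : ∑ s ∈ Finset.range t, (2 + (5 * n + p) + blockCost K color (ℓ s)) ≤ t * (56 * m) := by
      calc _ ≤ ∑ _s ∈ Finset.range t, 56 * m := Finset.sum_le_sum fun s _ => by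
            have := blockCost_le hK color (ℓ s)
            lia
        _ = t * (56 * m) := by simp
    lia
  have h2 : (((15 * m + 2 + ∑ s ∈ Finset.range t,
      (2 + (5 * n + p) + blockCost K color (ℓ s)) : ℕ)) : ℝ) ≤ 16 * m + t * (56 * m) := by
    exact_mod_cast h1
  refine h2.trans ?_
  have hm0 : (0 : ℝ) ≤ m := Nat.cast_nonneg m
  have hp1 : (1 : ℝ) ≤ p := by exact_mod_cast hp
  have hpR : 1 / 8 ≤ p * baseRate K ε := by nlinarith
  have h3 := mul_le_mul_of_nonneg_right hle (by positivity : (0 : ℝ) ≤ 56 * m)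
  have h4 := mul_le_mul_of_nonneg_left hpR hm0
  calc (16 : ℝ) * m + t * (56 * m) ≤ 128 * (m * (p * baseRate K ε)) +
        32 * (p * baseRate K ε) * (56 * m) := by linarith
    _ ≤ 2000 * (m * (p * baseRate K ε)) := by nlinarith
    _ = _ := by ring

section Random

variable {Ω : Type u} [MeasurableSpace Ω] {μ : Measure Ω} [IsProbabilityMeasure μ]

/-- Bounds for a block method that in each step draws an element `a` of a finite set uniformly at
random and replaces `x` by `f a x`: `γ` is the expected progress and `w a` the cost of a step. -/
lemma bounded_of_progress (hn : 2 ≤ n) (hK : Admissible K) (hb : Balanceable K) {ε : ℝ} (hε : 0 < ε)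
    (hε2 : ε ≤ 2) {α : Type} [Fintype α] {ξ : ℕ → Ω → α} (hξ : IsIIDUniform μ ξ)
    {f : α → (Fin n → ℝ) → Fin n → ℝ} {γ : ℝ} (hγ : 0 < γ)
    (hf : ∀ a x, total (scaling K (f a x)) ≤ total (scaling K x))
    (hprog : ∀ x, Fintype.card α * (γ * ∑ k, vertexImbalance (scaling K x) k ^ 2) ≤
      ∑ a, (total (scaling K x) - total (scaling K (f a x))))
    {w : α → ℝ} {b C B : ℝ} (hCB : 0 < C * B) (hw1 : ∀ a, 1 ≤ w a) (hwB : ∀ a, 4 * w a ≤ C * B)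
    (hwM : 512 / γ * baseRate K ε * ∑ a, w a ≤ Fintype.card α * (C * B))
    (hb0 : 0 ≤ b) (hbB : 4 * b ≤ C * B) {T : Ω → ℕ∞}
    (hT : ∀ ω t, IsEpsBalanced ε (scaling K (orbit f 0 (fun t => ξ t ω) t)) →
      ((T ω : ℕ∞) : ℝ≥0∞) ≤ ENNReal.ofReal (b + ∑ s ∈ Finset.range t, w (ξ s ω))) :
    BoundedInExpectationAndWHP μ T C B := by
  obtain ⟨xs, hxs⟩ := hb
  have hR := baseRate_ge hn hK hε hε2
  refine boundedInExpectationAndWHP_of_potential hξ (f := f)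
    (halted := fun x => IsEpsBalanced ε (scaling K x)) (I := fun x => total (scaling K x) ≤ total K)
    (fun x a hx => (hf a x).trans hx) (x := 0) (by rw [scaling_zero])
    (W := osbornePotential K ε γ xs) (M := 2 * (16 / γ) * baseRate K ε)
    (mul_pos (by positivity) (by linarith)) hCB
    (fun x _ => osbornePotential_nonneg hn hK hε hγ hxs x)
    (fun x hx => osbornePotential_le hn hK hε hγ hxs hx)
    (fun x hx hs => sum_potential_le hn hK hε hγ hxs hx hs (fun a => f a x) (fun a => hf a x)
      (hprog x)) hw1 hwB (le_trans (le_of_eq ?_) hwM) hb0 hbB hT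
  ring

lemma orbit_blockUpdate (color : Fin n → Fin p) (ℓ : ℕ → Fin p) (t : ℕ) :
    orbit (blockUpdate K color) 0 ℓ t = iterate K color ℓ t := by
  induction t with
  | zero => rfl
  | succ t ih => rw [orbit, iterate, ih]

lemma total_blockUpdate_le_total (hK : Admissible K) {color : Fin n → Fin p}
    (hc : IsColoring K color) (b : Fin p) (x : Fin n → ℝ) :
    total (scaling K (blockUpdate K color b x)) ≤ total (scaling K x) := by
  linarith [total_blockUpdate_le hK hc b x, blockImbalance_nonneg (scaling K x) color b]

lemma random_progress (hp : 0 < p) (hK : Admissible K) {color : Fin n → Fin p}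
    (hc : IsColoring K color) (x : Fin n → ℝ) :
    Fintype.card (Fin p) * (1 / (p : ℝ) * ∑ k, vertexImbalance (scaling K x) k ^ 2) ≤
      ∑ b, (total (scaling K x) - total (scaling K (blockUpdate K color b x))) := by
  have hp0 : (0 : ℝ) < p := by exact_mod_cast hp
  rw [Fintype.card_fin, ← mul_assoc, mul_one_div_cancel hp0.ne', one_mul,
    ← sum_blockImbalance _ color]
  exact Finset.sum_le_sum fun b _ => by linarith [total_blockUpdate_le hK hc b x]

lemma random_rounds (hn : 2 ≤ n) (hp : 0 < p) (hK : Admissible K) (hb : Balanceable K) {ε : ℝ}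
    (hε : 0 < ε) (hε2 : ε ≤ 2) {color : Fin n → Fin p} (hc : IsColoring K color)
    {ξ : ℕ → Ω → Fin p} (hξ : IsIIDUniform μ ξ) {C : ℝ} (hC : 1000 ≤ C) :
    BoundedInExpectationAndWHP μ (fun ω => rounds K ε color fun t => ξ t ω) C
      (p * baseRate K ε) := by
  have hp1 : (1 : ℝ) ≤ p := by exact_mod_cast hp
  have hR := baseRate_ge hn hK hε hε2
  have hpR : 1 / 8 ≤ p * baseRate K ε := by nlinarith
  have hCB : 1000 * (p * baseRate K ε) ≤ C * (p * baseRate K ε) :=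
    mul_le_mul_of_nonneg_right hC (by linarith)
  refine bounded_of_progress hn hK hb hε hε2 hξ (by positivity : (0 : ℝ) < 1 / p)
    (total_blockUpdate_le_total hK hc) (random_progress hp hK hc) (w := fun _ => 1) (b := 0)
    (by linarith) (fun _ => le_rfl) (fun _ => by linarith) ?_ le_rfl (by linarith) fun ω t ht => ?_
  · rw [one_div, div_inv_eq_mul, Finset.sum_const, Finset.card_univ, Fintype.card_fin,
      nsmul_eq_mul, mul_one, mul_comm]
    exact mul_le_mul_of_nonneg_left (by linarith) (by linarith)
  · rw [orbit_blockUpdate] at ht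
    refine (ENat.toENNReal_mono (rounds_le ht)).trans (le_of_eq ?_)
    rw [natCast_toENNReal]
    simp

lemma drawn_implements [NeZero n] (hK : Admissible K) (ε : ℝ) {color : Fin n → Fin p}
    (hc : IsColoring K color) (ℓ : ℕ → Fin p) : Implements K ε color (drawnChoice ℓ) ℓ :=
  implements_of_choose hK hc fun _ => rfl

lemma drawn_work_le [NeZero n] (hK : Admissible K) {ε : ℝ} {color : Fin n → Fin p}
    (hc : IsColoring K color) (ℓ : ℕ → Fin p) {t : ℕ}
    (ht : IsEpsBalanced ε (scaling K (iterate K color ℓ t))) :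
    ((work K ε color (drawnChoice ℓ) : ℕ∞) : ℝ≥0∞) ≤ ENNReal.ofReal (17 * numNonzero K +
      ∑ s ∈ Finset.range t, (3 + blockCost K color (ℓ s) : ℝ)) := by
  have hw := work_le (drawn_implements hK ε hc ℓ) (fun _ => rfl)
    (fun (t : ℕ) (s : State n) => (rfl : (drawnChoice ℓ t s).ops = 1)) ht
  refine (ENat.toENNReal_mono hw).trans ?_
  rw [natCast_toENNReal]
  refine ENNReal.ofReal_le_ofReal ?_
  have hm : (1 : ℝ) ≤ numNonzero K := by
    exact_mod_cast (Nat.one_le_iff_ne_zero.2 (NeZero.ne n)).trans (card_le_numNonzero hK)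
  push_cast
  linarith

/-- The operations of a sweep over all blocks: tests, draws and updates. -/
lemma sum_roundCost_le (hK : Admissible K) {color : Fin n → Fin p} (hc : IsColoring K color) :
    ∑ b, (3 + blockCost K color b : ℝ) ≤ 52 * numNonzero K := by
  have h1 := sum_blockCost_le hK color
  have h2 := hc.card_le.trans (card_le_numNonzero hK)
  have h3 : ∑ b, (3 + blockCost K color b) ≤ 52 * numNonzero K := by
    rw [Finset.sum_add_distrib, Finset.sum_const, Finset.card_univ, Fintype.card_fin, smul_eq_mul]
    lia
  exact_mod_cast h3

lemma random_work (hn : 2 ≤ n) (hp : 0 < p) (hK : Admissible K) (hb : Balanceable K) {ε : ℝ}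
    (hε : 0 < ε) (hε2 : ε ≤ 2) {color : Fin n → Fin p} (hc : IsColoring K color)
    {ξ : ℕ → Ω → Fin p} (hξ : IsIIDUniform μ ξ) {C : ℝ} (hC : 30000 ≤ C) :
    BoundedInExpectationAndWHP μ (fun ω => work K ε color (drawnChoice fun t => ξ t ω)) C
      (numNonzero K * baseRate K ε) := by
  have : NeZero n := ⟨by lia⟩
  have hp1 : (1 : ℝ) ≤ p := by exact_mod_cast hp
  have hR := baseRate_ge hn hK hε hε2
  have hm : (1 : ℝ) ≤ numNonzero K := by
    exact_mod_cast (Nat.one_le_iff_ne_zero.2 (NeZero.ne n)).trans (card_le_numNonzero hK)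
  have hsum := sum_roundCost_le hK hc
  set m : ℝ := ((numNonzero K : ℕ) : ℝ) with hmdef
  have hmR : m * (1 / 8) ≤ m * baseRate K ε := mul_le_mul_of_nonneg_left hR (by linarith)
  have hCB : 30000 * (m * baseRate K ε) ≤ C * (m * baseRate K ε) :=
    mul_le_mul_of_nonneg_right hC (by linarith)
  refine bounded_of_progress hn hK hb hε hε2 hξ (by positivity : (0 : ℝ) < 1 / p)
    (total_blockUpdate_le_total hK hc) (random_progress hp hK hc)
    (w := fun b => 3 + blockCost K color b) (b := 17 * m)
    (by linarith) (fun b => ?_) (fun b => ?_) ?_ (by linarith) (by linarith) fun ω t ht => ?_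
  · have : (0 : ℝ) ≤ blockCost K color b := Nat.cast_nonneg _
    linarith
  · have : (3 + blockCost K color b : ℝ) ≤ ∑ b, (3 + blockCost K color b : ℝ) :=
      Finset.single_le_sum (f := fun b => (3 + blockCost K color b : ℝ))
        (fun b _ => by positivity) (Finset.mem_univ b)
    linarith
  · rw [one_div, div_inv_eq_mul, Fintype.card_fin]
    have h1 := mul_le_mul_of_nonneg_left hsum
      (by positivity : 0 ≤ (512 * p : ℝ) * baseRate K ε)
    have h2 := mul_le_mul_of_nonneg_left hCB (by linarith : (0 : ℝ) ≤ p)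
    have h3 : 0 ≤ p * (m * baseRate K ε) := by
      have : 0 ≤ m * baseRate K ε := by linarith
      positivity
    linarith
  · rw [orbit_blockUpdate] at ht
    exact drawn_work_le hK hc _ ht

/-! ### Cyclic order -/

lemma cyclicOrder_mul_add (σ : ℕ → Equiv.Perm (Fin p)) (hp : 0 < p) (q : ℕ) {u : ℕ} (hu : u < p) :
    cyclicOrder σ hp (q * p + u) = cycleSeq hp (σ q) u := by
  have h1 : (q * p + u) / p = q := by
    rw [mul_comm, Nat.mul_add_div hp, Nat.div_eq_of_lt hu, add_zero]
  have h2 : (q * p + u) % p = u % p := by rw [mul_comm, Nat.mul_add_mod]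
  simp only [cyclicOrder, cycleSeq, h1, h2]

lemma orbit_cycleUpdate (color : Fin n → Fin p) (hp : 0 < p) (σ : ℕ → Equiv.Perm (Fin p)) (q : ℕ) :
    orbit (cycleUpdate K color hp) 0 σ q = iterate K color (cyclicOrder σ hp) (q * p) := by
  induction q with
  | zero => rw [zero_mul]; rfl
  | succ q ih =>
    rw [orbit, ih, cycleUpdate, add_mul, one_mul, iterate_eq_runFrom, iterate_eq_runFrom,
      runFrom_add]
    exact runFrom_congr K color _ fun u hu => (cyclicOrder_mul_add σ hp q hu).symm

lemma sum_cyclicOrder (hp : 0 < p) (σ : ℕ → Equiv.Perm (Fin p)) (F : Fin p → ℝ) (q : ℕ) :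
    ∑ s ∈ Finset.range (q * p), F (cyclicOrder σ hp s) = q * ∑ b, F b := by
  induction q with
  | zero => simp
  | succ q ih =>
    rw [add_mul, one_mul, Finset.sum_range_add, ih, Nat.cast_succ, add_mul, one_mul]
    congr 1
    rw [Finset.sum_range, ← Equiv.sum_comp (σ q) F]
    refine Finset.sum_congr rfl fun i _ => ?_
    rw [cyclicOrder_mul_add σ hp q i.2, cycleSeq_of_lt hp _ i.2]

lemma total_cycleUpdate_le (hK : Admissible K) {color : Fin n → Fin p} (hc : IsColoring K color)
    (hp : 0 < p) (σ : Equiv.Perm (Fin p)) (x : Fin n → ℝ) :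
    total (scaling K (cycleUpdate K color hp σ x)) ≤ total (scaling K x) := by
  have h := total_runFrom_antitone hK hc (cycleSeq hp σ) x (Nat.zero_le p)
  rwa [cycleUpdate]

lemma cyclic_rounds (hn : 2 ≤ n) (hp : 0 < p) (hK : Admissible K) (hb : Balanceable K) {ε : ℝ}
    (hε : 0 < ε) (hε2 : ε ≤ 2) {color : Fin n → Fin p} (hc : IsColoring K color)
    {σ : ℕ → Ω → Equiv.Perm (Fin p)} (hσ : IsIIDUniform μ σ) {C : ℝ} (hC : 40000 ≤ C) :
    BoundedInExpectationAndWHP μ (fun ω => rounds K ε color (cyclicOrder (fun q => σ q ω) hp)) C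
      ((p : ℝ) ^ (3 / 2 : ℝ) * baseRate K ε) := by
  have hp1 : (1 : ℝ) ≤ p := by exact_mod_cast hp
  have hs1 : 1 ≤ Real.sqrt p := Real.one_le_sqrt.2 hp1
  have hR := baseRate_ge hn hK hε hε2
  have hpow : (p : ℝ) ^ (3 / 2 : ℝ) = p * Real.sqrt p := by
    rw [Real.sqrt_eq_rpow, ← Real.rpow_one_add' (by linarith) (by norm_num)]
    norm_num
  rw [hpow]
  set S : ℝ := Real.sqrt p * baseRate K ε with hS
  have hS8 : 1 / 8 ≤ S := by nlinarith
  have e : (p : ℝ) * Real.sqrt p * baseRate K ε = p * S := by ring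
  rw [e]
  have hpS : p * (1 / 8) ≤ p * S := mul_le_mul_of_nonneg_left hS8 (by linarith)
  have hCB : 40000 * (p * S) ≤ C * (p * S) := mul_le_mul_of_nonneg_right hC (by linarith)
  refine bounded_of_progress hn hK hb hε hε2 hσ (by positivity : (0 : ℝ) < 1 / (68 * Real.sqrt p))
    (total_cycleUpdate_le hK hc hp) (cycle_progress hK hc hp) (w := fun _ => p) (b := 0)
    (by linarith) (fun _ => hp1) (fun _ => by linarith) ?_ le_rfl (by linarith) fun ω q ht => ?_
  · rw [one_div, div_inv_eq_mul, Finset.sum_const, Finset.card_univ, nsmul_eq_mul]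
    have e2 : 512 * (68 * Real.sqrt p) * baseRate K ε *
        ((Fintype.card (Equiv.Perm (Fin p)) : ℝ) * p) =
        (Fintype.card (Equiv.Perm (Fin p)) : ℝ) * (34816 * (p * S)) := by rw [hS]; ring
    rw [e2]
    exact mul_le_mul_of_nonneg_left (by linarith) (Nat.cast_nonneg _)
  · rw [orbit_cycleUpdate] at ht
    refine (ENat.toENNReal_mono (rounds_le ht)).trans (le_of_eq ?_)
    rw [natCast_toENNReal]
    simp

lemma cyclic_work (hn : 2 ≤ n) (hp : 0 < p) (hK : Admissible K) (hb : Balanceable K) {ε : ℝ}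
    (hε : 0 < ε) (hε2 : ε ≤ 2) {color : Fin n → Fin p} (hc : IsColoring K color)
    {σ : ℕ → Ω → Equiv.Perm (Fin p)} (hσ : IsIIDUniform μ σ) {C : ℝ} (hC : 2000000 ≤ C) :
    BoundedInExpectationAndWHP μ
      (fun ω => work K ε color (drawnChoice (cyclicOrder (fun q => σ q ω) hp))) C
      (numNonzero K * Real.sqrt p * baseRate K ε) := by
  have : NeZero n := ⟨by lia⟩
  have hp1 : (1 : ℝ) ≤ p := by exact_mod_cast hp
  have hs1 : 1 ≤ Real.sqrt p := Real.one_le_sqrt.2 hp1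
  have hR := baseRate_ge hn hK hε hε2
  have hm : (1 : ℝ) ≤ numNonzero K := by
    exact_mod_cast (Nat.one_le_iff_ne_zero.2 (NeZero.ne n)).trans (card_le_numNonzero hK)
  have hsum := sum_roundCost_le hK hc
  set m : ℝ := ((numNonzero K : ℕ) : ℝ) with hmdef
  set S : ℝ := Real.sqrt p * baseRate K ε with hS
  have hS8 : 1 / 8 ≤ S := by nlinarith
  have e : m * Real.sqrt p * baseRate K ε = m * S := by ring
  rw [e]
  have hmS : m * (1 / 8) ≤ m * S := mul_le_mul_of_nonneg_left hS8 (by linarith)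
  have hCB : 2000000 * (m * S) ≤ C * (m * S) := mul_le_mul_of_nonneg_right hC (by linarith)
  refine bounded_of_progress hn hK hb hε hε2 hσ (by positivity : (0 : ℝ) < 1 / (68 * Real.sqrt p))
    (total_cycleUpdate_le hK hc hp) (cycle_progress hK hc hp) (w := fun _ => 52 * m) (b := 17 * m)
    (by linarith) (fun _ => by linarith) (fun _ => by linarith) ?_ (by linarith) (by linarith)
    fun ω q ht => ?_
  · rw [one_div, div_inv_eq_mul, Finset.sum_const, Finset.card_univ, nsmul_eq_mul]
    have e2 : 512 * (68 * Real.sqrt p) * baseRate K ε *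
        ((Fintype.card (Equiv.Perm (Fin p)) : ℝ) * (52 * m)) =
        (Fintype.card (Equiv.Perm (Fin p)) : ℝ) * (1810432 * (m * S)) := by rw [hS]; ring
    rw [e2]
    exact mul_le_mul_of_nonneg_left (by linarith) (Nat.cast_nonneg _)
  · rw [orbit_cycleUpdate] at ht
    refine (drawn_work_le hK hc _ ht).trans (ENNReal.ofReal_le_ofReal ?_)
    rw [sum_cyclicOrder hp _ (fun b => (3 + blockCost K color b : ℝ))]
    simp only [Finset.sum_const, Finset.card_range, nsmul_eq_mul]
    have := mul_le_mul_of_nonneg_left hsum (Nat.cast_nonneg q : (0 : ℝ) ≤ q)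
    linarith

end Random

end Convergence

end BlockOsborne

end

theorem theorem7p1 :
    ∃ C : ℝ, 0 < C ∧
      ∀ (n p : ℕ) (hp : 0 < p) (K : Matrix (Fin n) (Fin n) ℝ) (ε : ℝ) (color : Fin n → Fin p),
        (∀ i j, 0 ≤ K i j) → (∀ i, ∃ j, K i j ≠ 0) → BlockOsborne.Balanceable K → 0 < ε →
        BlockOsborne.IsColoring K color →
        -- Greedy Block Osborne, with arbitrary tie-breaking
        ((∀ ℓ : ℕ → Fin p, BlockOsborne.IsGreedy K color ℓ →
            ((BlockOsborne.rounds K ε color ℓ : ℕ∞) : ENNReal) ≤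
              ENNReal.ofReal (C * (p * BlockOsborne.baseRate K ε))) ∧
          ∀ sel : ℕ → (Fin p → ℝ) → Fin p, (∀ (t : ℕ) (g : Fin p → ℝ) (b : Fin p), g b ≤ g (sel t g)) →
            (∃ ℓ : ℕ → Fin p, BlockOsborne.IsGreedy K color ℓ ∧
              BlockOsborne.Implements K ε color (BlockOsborne.greedyChoice color sel) ℓ) ∧
            (2 ≤ n → ε ≤ 2 →
              ((BlockOsborne.work K ε color (BlockOsborne.greedyChoice color sel) : ℕ∞) : ENNReal) ≤
                ENNReal.ofReal
                  (C * (BlockOsborne.numNonzero K * p * BlockOsborne.baseRate K ε)))) ∧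
        -- Random Block Osborne
        (∀ (Ω : Type u) [MeasurableSpace Ω] (μ : MeasureTheory.Measure Ω)
            [MeasureTheory.IsProbabilityMeasure μ] (ξ : ℕ → Ω → Fin p),
            BlockOsborne.IsIIDUniform μ ξ →
            BlockOsborne.BoundedInExpectationAndWHP μ
              (fun ω => BlockOsborne.rounds K ε color (fun t => ξ t ω))
              C (p * BlockOsborne.baseRate K ε) ∧
            (∀ ω, BlockOsborne.Implements K ε color
              (BlockOsborne.drawnChoice (fun t => ξ t ω)) (fun t => ξ t ω)) ∧
            (2 ≤ n → ε ≤ 2 →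
              BlockOsborne.BoundedInExpectationAndWHP μ
                (fun ω => BlockOsborne.work K ε color
                  (BlockOsborne.drawnChoice (fun t => ξ t ω)))
                C (BlockOsborne.numNonzero K * BlockOsborne.baseRate K ε))) ∧
        -- Cyclic Block Osborne, with an independent uniformly random order in each cycle
        (∀ (Ω : Type u) [MeasurableSpace Ω] (μ : MeasureTheory.Measure Ω)
            [MeasureTheory.IsProbabilityMeasure μ] (σ : ℕ → Ω → Equiv.Perm (Fin p)),
            BlockOsborne.IsIIDUniform μ σ →
            BlockOsborne.BoundedInExpectationAndWHP μ
              (fun ω => BlockOsborne.rounds K ε color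
                (BlockOsborne.cyclicOrder (fun q => σ q ω) hp))
              C ((p : ℝ) ^ (3 / 2 : ℝ) * BlockOsborne.baseRate K ε) ∧
            (∀ ω, BlockOsborne.Implements K ε color
              (BlockOsborne.drawnChoice (BlockOsborne.cyclicOrder (fun q => σ q ω) hp))
              (BlockOsborne.cyclicOrder (fun q => σ q ω) hp)) ∧
            (2 ≤ n → ε ≤ 2 →
              BlockOsborne.BoundedInExpectationAndWHP μ
                (fun ω => BlockOsborne.work K ε color
                  (BlockOsborne.drawnChoice (BlockOsborne.cyclicOrder (fun q => σ q ω) hp)))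
                C (BlockOsborne.numNonzero K * Real.sqrt p * BlockOsborne.baseRate K ε))) := by
  refine ⟨2000000, by norm_num, ?_⟩
  intro n p hp K ε color h0 hr hb hε hc
  have hK := BlockOsborne.Admissible.of_balanceable h0 hr hb
  have hn0 : n ≠ 0 := by
    have := hc.card_le
    lia
  have : NeZero n := ⟨hn0⟩
  -- outside the range `2 ≤ n`, `ε ≤ 2` no rounds are performed
  have htriv : ¬ (2 ≤ n ∧ ε ≤ 2) → ∀ ℓ, BlockOsborne.rounds K ε color ℓ = 0 := fun h ℓ =>
    BlockOsborne.rounds_eq_zero (BlockOsborne.isEpsBalanced_of_not hK hε h) color ℓ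
  refine ⟨⟨fun ℓ hℓ => ?_, fun sel hsel => ⟨?_, fun hn hε2 => ?_⟩⟩, ?_, ?_⟩
  · by_cases h : 2 ≤ n ∧ ε ≤ 2
    · refine (BlockOsborne.greedy_rounds_le h.1 hp hK hb hε hc hℓ).trans
        (ENNReal.ofReal_le_ofReal ?_)
      have hR := BlockOsborne.baseRate_ge h.1 hK hε h.2
      have : 0 ≤ p * BlockOsborne.baseRate K ε := mul_nonneg (Nat.cast_nonneg p) (by linarith)
      linarith
    · rw [htriv h]
      simp
  · obtain ⟨ℓ, hℓ, -, himp⟩ := BlockOsborne.exists_greedy_implements hK ε hc hsel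
    exact ⟨ℓ, hℓ, himp⟩
  · refine (BlockOsborne.greedy_work_le hn hp hK hb hε hε2 hc hsel).trans
      (ENNReal.ofReal_le_ofReal ?_)
    have hR := BlockOsborne.baseRate_ge hn hK hε hε2
    have : 0 ≤ BlockOsborne.numNonzero K * (p : ℝ) * BlockOsborne.baseRate K ε :=
      mul_nonneg (by positivity) (by linarith)
    linarith
  · intro Ω _ μ _ ξ hξ
    refine ⟨?_, fun ω => BlockOsborne.drawn_implements hK ε hc _, fun hn hε2 =>
      BlockOsborne.random_work hn hp hK hb hε hε2 hc hξ (by norm_num)⟩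
    by_cases h : 2 ≤ n ∧ ε ≤ 2
    · exact BlockOsborne.random_rounds h.1 hp hK hb hε h.2 hc hξ (by norm_num)
    · exact BlockOsborne.BoundedInExpectationAndWHP.of_eq_zero (fun ω => htriv h _) _ _
  · intro Ω _ μ _ σ hσ
    refine ⟨?_, fun ω => BlockOsborne.drawn_implements hK ε hc _, fun hn hε2 =>
      BlockOsborne.cyclic_work hn hp hK hb hε hε2 hc hσ le_rfl⟩
    by_cases h : 2 ≤ n ∧ ε ≤ 2
    · exact BlockOsborne.cyclic_rounds h.1 hp hK hb hε h.2 hc hσ (by norm_num)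
    · exact BlockOsborne.BoundedInExpectationAndWHP.of_eq_zero (fun ω => htriv h _) _ _
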